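/- Let $\mathfrak{age}(1)$ be the complex Lie algebra with basis $e,h,p,q,z$ and brackets $[h,e]=2e$, $[h,p]=p$, $[h,q]=-q$, $[e,p]=0$, $[e,q]=p$, $[p,q]=z$, $[z,\mathfrak{age}(1)]=0$, and let $(\cdot\mid\cdot)$ be the symmetric bilinear form on it with $(h\mid h)=1$ and all other pairings of basis vectors equal to $0$. Let $\widehat{\mathfrak{age}}(1)=\mathfrak{age}(1)\otimes\mathbb{C}[t,t^{-1}]\oplus\mathbb{C}k$ be the affine ageing algebra, in which $k$ is central and $$[\alpha\otimes t^m,\beta\otimes t^n]=[\alpha,\beta]\otimes t^{m+n}+m(\alpha\mid\beta)\delta_{m+n,0}\,k\qquad(\alpha,\beta\in\mathfrak{age}(1),\ m,n\in\mathbb{Z}),$$ and write $\alpha_n=\alpha\otimes t^n$. An $\widehat{\mathfrak{age}}(1)$-module $W$ is called restricted if for every $w\in W$ one has $e_mw=p_mw=q_mw=h_mw=z_mw=0$ for all sufficiently large $m$. Let $d_1,d_2,d_3\in\mathbb{Z}$ with $d_1+d_3\ge d_2$. Then $$\widehat{\mathfrak{age}}(1)_{(d_1,d_2,d_3)}=\sum_{i\ge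 0}(\mathbb{C}h_i\oplus\mathbb{C}e_{d_1+i}\oplus\mathbb{C}p_{d_2+i}\oplus\mathbb{C}q_{d_3+i})\oplus\sum_{i\in\mathbb{Z}}\mathbb{C}z_i\oplus\mathbb{C}k$$ is a subalgebra of $\widehat{\mathfrak{age}}(1)$. **Theorem 4.1.** Let $V$ be a simple $\widehat{\mathfrak{age}}(1)_{(d_1,d_2,d_3)}$-module. Suppose that there is an integer $l>d_2$ such that (a) $p_l$ acts injectively on $V$, and (b) for every $i\ge 1$, the elements $p_{l+i}$, $z_{l+d_2-d_1+i-1}$, $e_{l-d_3+i}$, $q_{l-d_1+i}$ and $h_{l-d_2+i}$ lie in $\widehat{\mathfrak{age}}(1)_{(d_1,d_2,d_3)}$ and annihilate $V$. Then the induced module $$\mathrm{Ind}(V)=U(\widehat{\mathfrak{age}}(1))\otimes_{U(\widehat{\mathfrak{age}}(1)_{(d_1,d_2,d_3)})}V$$ is a simple restricted $\widehat{\mathfrak{age}}(1)$-module. (The membership in (b) is only a restriction for the $e$'s and $q$'s, where it amounts to $d_1+d_3\le l+1$.) -/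

import Mathlib

open scoped TensorProduct

noncomputable section

/-! ### The `1`-spatial ageing algebra -/

/-- The names of the five basis vectors of the `1`-spatial ageing algebra. -/
inductive AgeGen
  | e | h | p | q | z
  deriving DecidableEq

/-- The five-dimensional complex vector space with basis `e, h, p, q, z`, given by coordinates; its
Lie bracket is defined below. -/
def Age : Type := AgeGen → ℂ

namespace Age

instance : AddCommGroup Age := inferInstanceAs (AddCommGroup (AgeGen → ℂ))

instance : Module ℂ Age := inferInstanceAs (Module ℂ (AgeGen → ℂ))

@[ext] theorem ext {x y : Age} (h : ∀ g, x g = y g) : x = y := funext h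

@[simp] theorem add_apply (x y : Age) (g : AgeGen) : (x + y) g = x g + y g := rfl

@[simp] theorem zero_apply (g : AgeGen) : (0 : Age) g = 0 := rfl

@[simp] theorem neg_apply (x : Age) (g : AgeGen) : (-x) g = -x g := rfl

@[simp] theorem smul_apply (c : ℂ) (x : Age) (g : AgeGen) : (c • x) g = c * x g := rfl

/-- The basis vector with a given name. -/
def gen (g : AgeGen) : Age := fun g' => if g' = g then 1 else 0

/-- The basis vector `e`. -/
def e : Age := gen .e

/-- The basis vector `h`. -/
def h : Age := gen .h

/-- The basis vector `p`. -/
def p : Age := gen .p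

/-- The basis vector `q`. -/
def q : Age := gen .q

/-- The basis vector `z`. -/
def z : Age := gen .z

/-- The bilinear extension of `[h,e] = 2e`, `[h,p] = p`, `[h,q] = -q`, `[e,p] = 0`, `[e,q] = p`,
`[p,q] = z`, `[z, -] = 0`, written in coordinates. -/
instance : Bracket Age Age where
  bracket x y := fun g =>
    match g with
    | .e => 2 * (x .h * y .e - x .e * y .h)
    | .h => 0
    | .p => (x .h * y .p - x .p * y .h) + (x .e * y .q - x .q * y .e)
    | .q => -(x .h * y .q - x .q * y .h)
    | .z => x .p * y .q - x .q * y .p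

theorem bracket_apply (x y : Age) (g : AgeGen) : (⁅x, y⁆ : Age) g =
    match g with
    | .e => 2 * (x .h * y .e - x .e * y .h)
    | .h => 0
    | .p => (x .h * y .p - x .p * y .h) + (x .e * y .q - x .q * y .e)
    | .q => -(x .h * y .q - x .q * y .h)
    | .z => x .p * y .q - x .q * y .p := rfl

instance : LieRing Age where
  add_lie x y w := by ext g; cases g <;> simp [bracket_apply] <;> ring
  lie_add x y w := by ext g; cases g <;> simp [bracket_apply] <;> ring
  lie_self x := by ext g; cases g <;> simp [bracket_apply] <;> ring
  leibniz_lie x y w := by ext g; cases g <;> simp [bracket_apply] <;> ring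

instance : LieAlgebra ℂ Age where
  lie_smul c x y := by ext g; cases g <;> simp [bracket_apply] <;> ring

/-- The symmetric bilinear form with `(h | h) = 1` and all other pairings of basis vectors zero. -/
def form : LinearMap.BilinForm ℂ Age :=
  LinearMap.mk₂ ℂ (fun x y => x .h * y .h)
    (fun _ _ _ => by simp [add_mul]) (fun _ _ _ => by simp [mul_assoc])
    (fun _ _ _ => by simp [mul_add]) (fun _ _ _ => by simp [mul_left_comm])

@[simp] theorem form_apply (x y : Age) : form x y = x .h * y .h := rfl

theorem neg_form_isSymm : (-form).IsSymm := ⟨fun x y => by simp [mul_comm]⟩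

theorem neg_form_lieInvariant : (-form).lieInvariant Age := fun x y w => by simp [bracket_apply]

end Age

/-! ### The affine ageing algebra -/

/-- The `2`-cocycle `(α ⊗ t^m, β ⊗ t^n) ↦ m (α | β) δ_{m+n,0}` on the loop algebra of `Age`.
Mathlib's residue pairing carries the factor `n` in place of `m`, hence the sign. -/
def ageCocycle : LieModule.Cohomology.twoCocycle ℂ (LieAlgebra.loopAlgebra ℂ ℤ Age)
    (TrivialLieModule ℂ (LieAlgebra.loopAlgebra ℂ ℤ Age) ℂ) :=
  LieAlgebra.LoopAlgebra.twoCocycleOfBilinear ℂ ℤ Age (-Age.form) Age.neg_form_lieInvariant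
    Age.neg_form_isSymm

/-- The affine ageing algebra: the vector space `Age ⊗ ℂ[t, t⁻¹] ⊕ ℂ k` with `k` central and
`[α ⊗ t^m, β ⊗ t^n] = [α, β] ⊗ t^(m+n) + m (α | β) δ_{m+n,0} k`, see `AffineAge.lie_mode_mode`. -/
abbrev AffineAge : Type := LieAlgebra.ofTwoCocycle ageCocycle

namespace AffineAge

/-- The element `α_n = α ⊗ t^n`. -/
def mode (α : Age) (n : ℤ) : AffineAge :=
  LieAlgebra.ofProd ageCocycle (AddMonoidAlgebra.single n 1 ⊗ₜ[ℂ] α, 0)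

/-- The central element `k`. -/
def k : AffineAge :=
  LieAlgebra.ofProd ageCocycle (0, (TrivialLieModule.equiv ℂ _ ℂ).symm 1)

theorem ageCocycle_apply (α β : Age) (m n : ℤ) :
    ageCocycle.1 (AddMonoidAlgebra.single m 1 ⊗ₜ[ℂ] α) (AddMonoidAlgebra.single n 1 ⊗ₜ[ℂ] β) =
      (TrivialLieModule.equiv ℂ _ ℂ).symm (if m + n = 0 then (m : ℂ) * Age.form α β else 0) := by
  rw [ageCocycle, LieAlgebra.LoopAlgebra.twoCocycleOfBilinear_coe,
    LieAlgebra.LoopAlgebra.twoCochainOfBilinear_apply_apply,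
    LieAlgebra.LoopAlgebra.residuePairing_apply_apply]
  congr 1
  rw [LieAlgebra.LoopAlgebra.toFinsupp_single_tmul, LieAlgebra.LoopAlgebra.toFinsupp_single_tmul,
    Finsupp.sum_single_index (by simp)]
  by_cases hmn : m + n = 0
  · obtain rfl : m = -n := by omega
    simp
  · rw [if_neg hmn, Finsupp.single_eq_of_ne (by omega)]
    simp

theorem lie_mode_mode (α β : Age) (m n : ℤ) :
    ⁅mode α m, mode β n⁆ =
      mode ⁅α, β⁆ (m + n) + (if m + n = 0 then (m : ℂ) * Age.form α β else 0) • k := by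
  rw [LieAlgebra.bracket_ofTwoCocycle]
  simp only [mode, k, Equiv.symm_apply_apply, ← LieAlgebra.of_smul, ← LieAlgebra.of_add,
    trivial_lie_zero]
  refine congrArg _ (Prod.ext ?_ ?_)
  · rw [Prod.fst_add, Prod.smul_fst, smul_zero, add_zero,
      LieAlgebra.ExtendScalars.bracket_tmul, AddMonoidAlgebra.single_mul_single, one_mul]
    exact (add_zero _).symm
  · rw [Prod.snd_add, Prod.smul_snd, add_zero, sub_zero, zero_add, ← map_smul, smul_eq_mul, mul_one]
    exact ageCocycle_apply α β m n

theorem k_lie (x : AffineAge) : ⁅k, x⁆ = 0 := by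
  rw [LieAlgebra.bracket_ofTwoCocycle]
  simp only [k, Equiv.symm_apply_apply, trivial_lie_zero]
  rw [← LieAlgebra.of_zero]
  exact congrArg _ (Prod.ext (by simp) (by simp))

theorem lie_k (x : AffineAge) : ⁅x, k⁆ = 0 := by
  rw [← lie_skew, k_lie, neg_zero]

theorem mode_smul (c : ℂ) (α : Age) (n : ℤ) : mode (c • α) n = c • mode α n := by
  simp [mode, ← LieAlgebra.of_smul]

/-- The elements `h_i, e_{d₁+i}, p_{d₂+i}, q_{d₃+i}` (`i ≥ 0`), `z_i` (`i ∈ ℤ`) and `k`. -/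
inductive SubGen (d₁ d₂ d₃ : ℤ) : AffineAge → Prop
  | h (i : ℕ) : SubGen d₁ d₂ d₃ (mode Age.h i)
  | e (i : ℕ) : SubGen d₁ d₂ d₃ (mode Age.e (d₁ + i))
  | p (i : ℕ) : SubGen d₁ d₂ d₃ (mode Age.p (d₂ + i))
  | q (i : ℕ) : SubGen d₁ d₂ d₃ (mode Age.q (d₃ + i))
  | z (i : ℤ) : SubGen d₁ d₂ d₃ (mode Age.z i)
  | k : SubGen d₁ d₂ d₃ k

theorem SubGen.mode_mem {d₁ d₂ d₃ : ℤ} (g : AgeGen) (n : ℤ)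
    (hn : match g with
      | .e => d₁ ≤ n
      | .h => 0 ≤ n
      | .p => d₂ ≤ n
      | .q => d₃ ≤ n
      | .z => True) : SubGen d₁ d₂ d₃ (mode (Age.gen g) n) := by
  cases g with
  | e => obtain ⟨i, rfl⟩ := Int.le.dest hn; exact .e i
  | h => obtain ⟨i, rfl⟩ := Int.eq_ofNat_of_zero_le hn; exact .h i
  | p => obtain ⟨i, rfl⟩ := Int.le.dest hn; exact .p i
  | q => obtain ⟨i, rfl⟩ := Int.le.dest hn; exact .q i
  | z => exact .z n

theorem SubGen.cases_mode {d₁ d₂ d₃ : ℤ} {x : AffineAge} (hx : SubGen d₁ d₂ d₃ x) :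
    x = AffineAge.k ∨ ∃ (g : AgeGen) (n : ℤ), x = mode (Age.gen g) n ∧
      match g with
      | .e => d₁ ≤ n
      | .h => 0 ≤ n
      | .p => d₂ ≤ n
      | .q => d₃ ≤ n
      | .z => True := by
  cases hx with
  | k => exact .inl rfl
  | h i => exact .inr ⟨.h, _, rfl, by simp⟩
  | e i => exact .inr ⟨.e, _, rfl, by simp⟩
  | p i => exact .inr ⟨.p, _, rfl, by simp⟩
  | q i => exact .inr ⟨.q, _, rfl, by simp⟩
  | z i => exact .inr ⟨.z, _, rfl, trivial⟩

theorem SubGen.lie_mem {d₁ d₂ d₃ : ℤ} (hd : d₂ ≤ d₁ + d₃) {x y : AffineAge}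
    (hx : SubGen d₁ d₂ d₃ x) (hy : SubGen d₁ d₂ d₃ y) :
    ⁅x, y⁆ ∈ Submodule.span ℂ {x | SubGen d₁ d₂ d₃ x} := by
  obtain rfl | ⟨a, m, rfl, hm⟩ := hx.cases_mode
  · rw [k_lie]; exact Submodule.zero_mem _
  obtain rfl | ⟨b, n, rfl, hn⟩ := hy.cases_mode
  · rw [lie_k]; exact Submodule.zero_mem _
  rw [lie_mode_mode]
  refine Submodule.add_mem _ ?_ (Submodule.smul_mem _ _ (Submodule.subset_span .k))
  have key : ∃ (c : ℂ) (g : AgeGen), ⁅Age.gen a, Age.gen b⁆ = c • Age.gen g ∧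
      (c = 0 ∨ SubGen d₁ d₂ d₃ (mode (Age.gen g) (m + n))) := by
    have lie_gen (c : ℂ) (g : AgeGen) (H : ∀ g', (⁅Age.gen a, Age.gen b⁆ : Age) g' =
        c * Age.gen g g') : ⁅Age.gen a, Age.gen b⁆ = c • Age.gen g := Age.ext H
    cases a <;> cases b <;> simp only at hm hn
    case h.e => exact ⟨2, .e, lie_gen _ _ (by rintro (_ | _) <;> simp [Age.bracket_apply, Age.gen]),
      .inr (.mode_mem _ _ (by simp only; omega))⟩
    case e.h => exact ⟨-2, .e, lie_gen _ _ (by rintro (_ | _) <;> simp [Age.bracket_apply, Age.gen]),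
      .inr (.mode_mem _ _ (by simp only; omega))⟩
    case h.p => exact ⟨1, .p, lie_gen _ _ (by rintro (_ | _) <;> simp [Age.bracket_apply, Age.gen]),
      .inr (.mode_mem _ _ (by simp only; omega))⟩
    case p.h => exact ⟨-1, .p, lie_gen _ _ (by rintro (_ | _) <;> simp [Age.bracket_apply, Age.gen]),
      .inr (.mode_mem _ _ (by simp only; omega))⟩
    case h.q => exact ⟨-1, .q, lie_gen _ _ (by rintro (_ | _) <;> simp [Age.bracket_apply, Age.gen]),
      .inr (.mode_mem _ _ (by simp only; omega))⟩
    case q.h => exact ⟨1, .q, lie_gen _ _ (by rintro (_ | _) <;> simp [Age.bracket_apply, Age.gen]),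
      .inr (.mode_mem _ _ (by simp only; omega))⟩
    case e.q => exact ⟨1, .p, lie_gen _ _ (by rintro (_ | _) <;> simp [Age.bracket_apply, Age.gen]),
      .inr (.mode_mem _ _ (by simp only; omega))⟩
    case q.e => exact ⟨-1, .p, lie_gen _ _ (by rintro (_ | _) <;> simp [Age.bracket_apply, Age.gen]),
      .inr (.mode_mem _ _ (by simp only; omega))⟩
    case p.q => exact ⟨1, .z, lie_gen _ _ (by rintro (_ | _) <;> simp [Age.bracket_apply, Age.gen]),
      .inr (.mode_mem _ _ trivial)⟩
    case q.p => exact ⟨-1, .z, lie_gen _ _ (by rintro (_ | _) <;> simp [Age.bracket_apply, Age.gen]),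
      .inr (.mode_mem _ _ trivial)⟩
    all_goals exact ⟨0, .z, lie_gen _ _ (by rintro (_ | _) <;> simp [Age.bracket_apply, Age.gen]),
      .inl rfl⟩
  obtain ⟨c, g, hg, hc⟩ := key
  rw [hg, mode_smul]
  obtain rfl | hc := hc
  · rw [zero_smul]; exact Submodule.zero_mem _
  · exact Submodule.smul_mem _ _ (Submodule.subset_span hc)

/-- The subalgebra `∑_{i ≥ 0} (ℂ h_i ⊕ ℂ e_{d₁+i} ⊕ ℂ p_{d₂+i} ⊕ ℂ q_{d₃+i}) ⊕ ∑_{i ∈ ℤ} ℂ z_i ⊕ ℂ k`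
of the affine ageing algebra; it is closed under the bracket because `d₂ ≤ d₁ + d₃`. -/
def sub (d₁ d₂ d₃ : ℤ) (hd : d₂ ≤ d₁ + d₃) : LieSubalgebra ℂ AffineAge where
  toSubmodule := Submodule.span ℂ {x | SubGen d₁ d₂ d₃ x}
  lie_mem' {x y} hx hy := by
    induction hx, hy using Submodule.span_induction₂ with
    | mem_mem x y hx hy => exact SubGen.lie_mem hd hx hy
    | zero_left y hy => rw [zero_lie]; exact Submodule.zero_mem _
    | zero_right x hx => rw [lie_zero]; exact Submodule.zero_mem _
    | add_left x y z _ _ _ h₁ h₂ => rw [add_lie]; exact Submodule.add_mem _ h₁ h₂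
    | add_right x y z _ _ _ h₁ h₂ => rw [lie_add]; exact Submodule.add_mem _ h₁ h₂
    | smul_left c x y _ _ h => rw [smul_lie]; exact Submodule.smul_mem _ _ h
    | smul_right c x y _ _ h => rw [lie_smul]; exact Submodule.smul_mem _ _ h

/-- A module `W` over the affine ageing algebra is restricted if every `w` in `W` is annihilated by
`e_m`, `p_m`, `q_m`, `h_m` and `z_m` for all sufficiently large `m`. -/
def IsRestricted (W : Type*) [AddCommGroup W] [LieRingModule AffineAge W] : Prop :=
  ∀ w : W, ∃ N : ℤ, ∀ m : ℤ, N ≤ m →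
    ⁅mode Age.e m, w⁆ = 0 ∧ ⁅mode Age.p m, w⁆ = 0 ∧ ⁅mode Age.q m, w⁆ = 0 ∧
      ⁅mode Age.h m, w⁆ = 0 ∧ ⁅mode Age.z m, w⁆ = 0

end AffineAge

/-! ### Action of single elements of a subalgebra -/

section Action

variable {R L : Type*} [CommRing R] [LieRing L] [LieAlgebra R L] (S : LieSubalgebra R L)
  (V : Type*) [AddCommGroup V] [LieRingModule S V]

/-- The element `x` of the ambient Lie algebra lies in `S` and annihilates the `S`-module `V`. -/
def LieSubalgebra.Annihilates (x : L) : Prop :=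
  ∃ hx : x ∈ S, ∀ v : V, ⁅(⟨x, hx⟩ : S), v⁆ = 0

/-- The element `x` of the ambient Lie algebra lies in `S` and acts injectively on the `S`-module
`V`. -/
def LieSubalgebra.ActsInjectively (x : L) : Prop :=
  ∃ hx : x ∈ S, Function.Injective fun v : V => ⁅(⟨x, hx⟩ : S), v⁆

end Action

/-! ### Induced modules -/

namespace LieInduced

attribute [local instance 100] LieRing.ofAssociativeRing

variable {R L : Type*} [CommRing R] [LieRing L] [LieAlgebra R L] (S : LieSubalgebra R L)
  (V : Type*) [AddCommGroup V] [Module R V] [LieRingModule S V] [LieModule R S V]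

/-- The algebra map `U(S) → U(L)` induced by the inclusion of `S` in `L`. It makes `U(L)` a right
`U(S)`-module. -/
def envMap : UniversalEnvelopingAlgebra R S →ₐ[R] UniversalEnvelopingAlgebra R L :=
  UniversalEnvelopingAlgebra.lift R ((UniversalEnvelopingAlgebra.ι R).comp S.incl)

/-- The action of `U(S)` on the `S`-module `V`. -/
def envAct : UniversalEnvelopingAlgebra R S →ₐ[R] Module.End R V :=
  UniversalEnvelopingAlgebra.lift R (LieModule.toEnd R S V)

/-- The balancing relations `u a ⊗ v = u ⊗ a v` for `u ∈ U(L)`, `a ∈ U(S)`, `v ∈ V`. -/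
def balanced : Submodule (UniversalEnvelopingAlgebra R L)
    (UniversalEnvelopingAlgebra R L ⊗[R] V) :=
  Submodule.span _ {x | ∃ (u : UniversalEnvelopingAlgebra R L)
    (a : UniversalEnvelopingAlgebra R S) (v : V),
      x = (u * envMap S a) ⊗ₜ[R] v - u ⊗ₜ[R] (envAct S V a v)}

end LieInduced

section Induced

variable {R L : Type*} [CommRing R] [LieRing L] [LieAlgebra R L] (S : LieSubalgebra R L)
  (V : Type*) [AddCommGroup V] [Module R V] [LieRingModule S V] [LieModule R S V]

/-- The induced module `U(L) ⊗_{U(S)} V` of a module `V` over a Lie subalgebra `S` of `L`: the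
quotient of `U(L) ⊗_R V` by the balancing relations. -/
def LieInduced : Type _ :=
  (UniversalEnvelopingAlgebra R L ⊗[R] V) ⧸ LieInduced.balanced S V

namespace LieInduced

attribute [local instance 100] LieRing.ofAssociativeRing

instance : AddCommGroup (LieInduced S V) :=
  inferInstanceAs (AddCommGroup ((UniversalEnvelopingAlgebra R L ⊗[R] V) ⧸ balanced S V))

instance : Module (UniversalEnvelopingAlgebra R L) (LieInduced S V) :=
  inferInstanceAs (Module (UniversalEnvelopingAlgebra R L)
    ((UniversalEnvelopingAlgebra R L ⊗[R] V) ⧸ balanced S V))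

instance : Module R (LieInduced S V) :=
  inferInstanceAs (Module R ((UniversalEnvelopingAlgebra R L ⊗[R] V) ⧸ balanced S V))

instance : IsScalarTower R (UniversalEnvelopingAlgebra R L) (LieInduced S V) :=
  inferInstanceAs (IsScalarTower R (UniversalEnvelopingAlgebra R L)
    ((UniversalEnvelopingAlgebra R L ⊗[R] V) ⧸ balanced S V))

/-- `L` acts on the induced module through left multiplication by its image in `U(L)`. -/
instance : LieRingModule L (LieInduced S V) where
  bracket x m := UniversalEnvelopingAlgebra.ι R x • m
  add_lie x y m := by
    change UniversalEnvelopingAlgebra.ι R (x + y) • m = _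
    rw [map_add, add_smul]
  lie_add x m n := smul_add _ m n
  leibniz_lie x y m := by
    change UniversalEnvelopingAlgebra.ι R x • UniversalEnvelopingAlgebra.ι R y • m =
      UniversalEnvelopingAlgebra.ι R ⁅x, y⁆ • m +
        UniversalEnvelopingAlgebra.ι R y • UniversalEnvelopingAlgebra.ι R x • m
    rw [LieHom.map_lie, LieRing.of_associative_ring_bracket, sub_smul, mul_smul, mul_smul,
      sub_add_cancel]

theorem lie_def (x : L) (m : LieInduced S V) : ⁅x, m⁆ = UniversalEnvelopingAlgebra.ι R x • m := rfl

instance : LieModule R L (LieInduced S V) where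
  smul_lie c x m := by rw [lie_def, lie_def, map_smul, smul_assoc]
  lie_smul c x m := by rw [lie_def, lie_def, smul_algebra_smul_comm]

end LieInduced

end Induced

end

/-!
Write `S` for the subalgebra, `W` for the induced module and `j : V → W` for the canonical map.

**`j` is injective.** No Poincaré-Birkhoff-Witt theorem is needed beyond the following special case.
If `x` normalizes a subalgebra `S` up to multiples of `x`, then every `S`-module `V` embeds into a
module over `S + ℂ x`, namely `V[x]`, on which the action of `S` is forced by recursion on the
degree in `x` (`LiePartialRep.Extends.sup_span_singleton`). Increasing unions are handled by
sequences modulo eventually zero sequences (`LiePartialRep.Extends.iSup_of_monotone`). Adjoining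
modes of `p, e, q` one at a time, and then those of `h`, leads from `S` to the whole affine algebra
(`AffineAge.extends_top`). A module over the whole algebra that contains `V` receives a map from
`W`, so `j` is injective (`LieInduced.incl_injective`).

**Every nonzero submodule of `W` meets `j V`.** The module `W` is spanned by words in the modes
outside `S`, applied to `j V`. Give these modes the weights
`4j - 2, 4j + 3, 4j - 3, 4j` for `e_{d₁-j}, h_{-j}, p_{d₂-j}, q_{d₃-j}` and filter `W` by total
weight. Each mode `g_n` outside `S` has a detecting mode `g'_{l-n}`, where `g ↔ g'` exchanges `h`
with `p` and `e` with `q`: it annihilates `V` by the hypothesis, and its bracket with `g_n` is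
`± p_l`. The weights are such that all other brackets that occur are of strictly lower order
(`AffineAge.IsTruncated.isDetected`). So on leading terms, which are polynomials in the modes
outside `S` with coefficients in `V`, the detecting mode acts, up to sign, as `∂/∂g_n` followed by
`p_l` on the coefficients. Since `p_l` is injective on `V` and the characteristic is zero, suitable
detecting modes move any nonzero element to a nonzero element of `j V`
(`LoweringWords.IsDetected.exists_ne_zero`). This argument works with formal leading terms and does
not presuppose that different ones give different elements of `W`. As `V` is simple and generates
`W`, the induced module is simple.

**Restrictedness** holds on `j V` by the hypothesis, and the elements at which it holds form a
submodule.
-/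

noncomputable section

/-! ### Extending representations along chains of subspaces -/

namespace LiePartialRep

universe u v w

variable {K : Type u} {L : Type v} [Field K] [LieRing L] [LieAlgebra K L]

/-- A linear map `ρ : L → End M` is a representation on the subspace `T` of `L` if it respects the
bracket of any two elements of `T`. For a subalgebra `T` this amounts to a `T`-module structure on
`M`, extended to `L` by an arbitrary choice of linear extension. -/
def IsRepOn {M : Type w} [AddCommGroup M] [Module K M] (T : Submodule K L)
    (ρ : L →ₗ[K] Module.End K M) : Prop :=
  ∀ x ∈ T, ∀ y ∈ T, ∀ m, ρ ⁅x, y⁆ m = ρ x (ρ y m) - ρ y (ρ x m)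

/-- Every representation on `S` embeds `S`-equivariantly into a representation on `T`. -/
def Extends (S T : Submodule K L) : Prop :=
  ∀ (V : Type w) [AddCommGroup V] [Module K V] (ρ : L →ₗ[K] Module.End K V), IsRepOn S ρ →
    ∃ (M : Type w) (_ : AddCommGroup M) (_ : Module K M) (σ : L →ₗ[K] Module.End K M)
      (j : V →ₗ[K] M), IsRepOn T σ ∧ Function.Injective j ∧
        ∀ s ∈ S, ∀ v, j (ρ s v) = σ s (j v)

theorem Extends.mono {S T T' : Submodule K L} (h : Extends.{u, v, w} S T) (hT : T' ≤ T) :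
    Extends.{u, v, w} S T' := by
  intro V _ _ ρ hρ
  obtain ⟨M, _, _, σ, j, hσ, hj, hjs⟩ := h V ρ hρ
  exact ⟨M, _, _, σ, j, fun x hx y hy m => hσ x (hT hx) y (hT hy) m, hj, hjs⟩

theorem Extends.refl (S : Submodule K L) : Extends.{u, v, w} S S :=
  fun V _ _ ρ hρ => ⟨V, _, _, ρ, LinearMap.id, hρ, Function.injective_id, fun _ _ _ => rfl⟩

theorem Extends.trans {S T U : Submodule K L} (h : Extends.{u, v, w} S T)
    (h' : Extends.{u, v, w} T U) (hST : S ≤ T) : Extends.{u, v, w} S U := by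
  intro V _ _ ρ hρ
  obtain ⟨M, _, _, σ, j, hσ, hj, hjs⟩ := h V ρ hρ
  obtain ⟨N, _, _, τ, i, hτ, hi, his⟩ := h' M σ hσ
  refine ⟨N, _, _, τ, i ∘ₗ j, hτ, hi.comp hj, fun s hs v => ?_⟩
  simp [hjs s hs, his s (hST hs)]

section Step

variable {V : Type w} [AddCommGroup V] [Module K V] (ρ : L →ₗ[K] Module.End K V)
  (lam : L →ₗ[K] K) (δ : L →ₗ[K] L)

/-- Multiplication by the new element `x` on `V[x] = ⨁ xⁿ V`. -/
def shift : (ℕ →₀ V) →ₗ[K] (ℕ →₀ V) := Finsupp.lmapDomain V K Nat.succ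

@[simp] theorem shift_single (n : ℕ) (v : V) :
    shift (K := K) (Finsupp.single n v) = Finsupp.single (n + 1) v := by
  simp [shift]

/-- The action of `y` on `xⁿ V`, determined by `y xⁿ⁺¹ = x y xⁿ + lam(y) xⁿ⁺¹ + δ(y) xⁿ`. -/
def stepAux : ℕ → L →ₗ[K] V →ₗ[K] (ℕ →₀ V)
  | 0 => (LinearMap.compRight K (Finsupp.lsingle 0)) ∘ₗ ρ
  | n + 1 => (LinearMap.compRight K shift) ∘ₗ stepAux n +
      lam.smulRight (Finsupp.lsingle (n + 1)) + stepAux n ∘ₗ δ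

/-- The action on `V[x]` of the elements commuting with `x` up to `lam` and `δ`. -/
def stepAct : L →ₗ[K] Module.End K (ℕ →₀ V) where
  toFun y := Finsupp.lsum K fun n => stepAux ρ lam δ n y
  map_add' y y' := by ext; simp
  map_smul' c y := by ext; simp

theorem stepAct_single_zero (y : L) (v : V) :
    stepAct ρ lam δ y (Finsupp.single 0 v) = Finsupp.single 0 (ρ y v) := by
  simp [stepAct, stepAux]

theorem stepAct_shift (y : L) (m : ℕ →₀ V) :
    stepAct ρ lam δ y (shift (K := K) m) = shift (K := K) (stepAct ρ lam δ y m) +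
      lam y • shift (K := K) m + stepAct ρ lam δ (δ y) m := by
  induction m using Finsupp.induction_linear with
  | zero => simp
  | add f g hf hg => simp only [map_add, hf, hg, smul_add]; abel
  | single n v => rw [shift_single]; simp [stepAct, stepAux]

theorem stepAct_lie {S : Submodule K L} (hρ : IsRepOn S ρ) (hδ : ∀ s ∈ S, δ s ∈ S)
    (hlam : ∀ s ∈ S, ∀ s' ∈ S, lam ⁅s, s'⁆ = 0)
    (hder : ∀ s ∈ S, ∀ s' ∈ S, δ ⁅s, s'⁆ = ⁅δ s, s'⁆ + ⁅s, δ s'⁆ + lam s' • δ s - lam s • δ s') :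
    IsRepOn S (stepAct ρ lam δ) := by
  suffices H : ∀ (n : ℕ) (v : V), ∀ s ∈ S, ∀ s' ∈ S,
      stepAct ρ lam δ ⁅s, s'⁆ (Finsupp.single n v) =
        stepAct ρ lam δ s (stepAct ρ lam δ s' (Finsupp.single n v)) -
          stepAct ρ lam δ s' (stepAct ρ lam δ s (Finsupp.single n v)) by
    intro s hs s' hs' m
    induction m using Finsupp.induction_linear with
    | zero => simp
    | add f g hf hg => simp only [map_add, hf, hg]; abel
    | single n v => exact H n v s hs s' hs'
  intro n v
  induction n with
  | zero => intro s hs s' hs'; simp [stepAct_single_zero, hρ s hs s' hs']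
  | succ n ih =>
    intro s hs s' hs'
    rw [← shift_single (K := K)]
    simp only [stepAct_shift, map_add, map_smul, hder s hs s' hs', hlam s hs s' hs', map_sub,
      LinearMap.add_apply, LinearMap.sub_apply, LinearMap.smul_apply, ih s hs s' hs',
      ih _ (hδ s hs) s' hs', ih s hs _ (hδ s' hs')]
    module

end Step

/-- Adjoining one element `x` that normalizes `S` modulo multiples of `x`: the extended module is
`V[x]`. -/
theorem Extends.sup_span_singleton {S : Submodule K L} (hS : ∀ s ∈ S, ∀ s' ∈ S, ⁅s, s'⁆ ∈ S)
    {x : L} (hx : ∀ s ∈ S, ⁅s, x⁆ ∈ S ⊔ Submodule.span K {x}) :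
    Extends.{u, v, w} S (S ⊔ Submodule.span K {x}) := by
  by_cases hxS : x ∈ S
  · rw [sup_eq_left.2 ((Submodule.span_singleton_le_iff_mem x S).2 hxS)]
    exact Extends.refl S
  obtain ⟨φ₀, hφ₀x, hφ₀S⟩ := Submodule.exists_le_ker_of_notMem hxS
  -- normalize the functional so that it takes the value `1` at `x`
  obtain ⟨φ, hφx, hφS⟩ : ∃ φ : L →ₗ[K] K, φ x = 1 ∧ ∀ s ∈ S, φ s = 0 :=
    ⟨(φ₀ x)⁻¹ • φ₀, by simp [hφ₀x], fun s hs => by simp [LinearMap.mem_ker.1 (hφ₀S hs)]⟩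
  have hmem : ∀ y ∈ S ⊔ Submodule.span K {x}, y - φ y • x ∈ S := by
    intro y hy
    obtain ⟨s, hs, t, ht, rfl⟩ := Submodule.mem_sup.1 hy
    obtain ⟨c, rfl⟩ := Submodule.mem_span_singleton.1 ht
    simpa [hφS s hs, hφx] using hs
  let lam : L →ₗ[K] K :=
    { toFun := fun y => φ ⁅y, x⁆
      map_add' := by simp
      map_smul' := by simp }
  let δ : L →ₗ[K] L :=
    { toFun := fun y => ⁅y, x⁆ - φ ⁅y, x⁆ • x
      map_add' := fun y y' => by simp only [add_lie, map_add]; module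
      map_smul' := fun c y => by
        simp only [smul_lie, map_smul, RingHom.id_apply, smul_eq_mul]; module }
  have hlam : ∀ y, lam y = φ ⁅y, x⁆ := fun _ => rfl
  have hδ : ∀ y, δ y = ⁅y, x⁆ - lam y • x := fun _ => rfl
  have hlie : ∀ y, ⁅y, x⁆ = δ y + lam y • x := fun y => by rw [hδ]; module
  have hδS : ∀ s ∈ S, δ s ∈ S := fun s hs => hmem _ (hx s hs)
  have jac : ∀ s s', ⁅⁅s, s'⁆, x⁆ = ⁅δ s, s'⁆ + ⁅s, δ s'⁆ + lam s' • δ s - lam s • δ s' := by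
    intro s s'
    have e1 : ⁅s, δ s'⁆ = ⁅s, ⁅s', x⁆⁆ - lam s' • ⁅s, x⁆ := by rw [hδ, lie_sub, lie_smul]
    have e2 : ⁅δ s, s'⁆ = -⁅s', ⁅s, x⁆⁆ + lam s • ⁅s', x⁆ := by
      rw [hδ, sub_lie, smul_lie, ← lie_skew ⁅s, x⁆ s', ← lie_skew x s']; module
    rw [e1, e2, lie_lie, hδ s, hδ s']
    module
  have hlam0 : ∀ s ∈ S, ∀ s' ∈ S, lam ⁅s, s'⁆ = 0 := by
    intro s hs s' hs'
    rw [hlam, jac]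
    refine hφS _ (S.sub_mem (S.add_mem (S.add_mem ?_ ?_) ?_) ?_)
    · exact hS _ (hδS s hs) _ hs'
    · exact hS _ hs _ (hδS s' hs')
    · exact S.smul_mem _ (hδS s hs)
    · exact S.smul_mem _ (hδS s' hs')
  intro V _ _ ρ hρ
  have hrep : IsRepOn S (stepAct ρ lam δ) := stepAct_lie ρ lam δ hρ hδS hlam0
    (fun s hs s' hs' => by rw [hδ ⁅s, s'⁆, hlam0 s hs s' hs', zero_smul, sub_zero, jac])
  let σ : L →ₗ[K] Module.End K (ℕ →₀ V) :=
    { toFun := fun y => stepAct ρ lam δ (y - φ y • x) + φ y • shift (K := K)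
      map_add' := fun y y' => by
        simp only [map_add, map_sub, map_smul]
        module
      map_smul' := fun c y => by ext1; simp [mul_smul, smul_sub] }
  have hσS : ∀ s ∈ S, ∀ m, σ s m = stepAct ρ lam δ s m := fun s hs m => by
    simp [σ, hφS s hs]
  have hσx : ∀ m, σ x m = shift (K := K) m := fun m => by simp [σ, hφx]
  have hσδ : ∀ s ∈ S, ∀ m, σ ⁅s, x⁆ m = σ s (σ x m) - σ x (σ s m) := by
    intro s hs m
    rw [hlie, map_add, map_smul, LinearMap.add_apply, LinearMap.smul_apply, hσx, hσx, hσS s hs,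
      hσS s hs, hσS _ (hδS s hs), stepAct_shift]
    module
  refine ⟨ℕ →₀ V, inferInstance, inferInstance, σ, Finsupp.lsingle 0, ?_,
    Finsupp.single_injective 0, ?_⟩
  · intro y hy y' hy' m
    obtain ⟨s, hs, t, ht, rfl⟩ := Submodule.mem_sup.1 hy
    obtain ⟨c, rfl⟩ := Submodule.mem_span_singleton.1 ht
    obtain ⟨s', hs', t', ht', rfl⟩ := Submodule.mem_sup.1 hy'
    obtain ⟨c', rfl⟩ := Submodule.mem_span_singleton.1 ht'
    have e : ⁅s + c • x, s' + c' • x⁆ = ⁅s, s'⁆ + c' • ⁅s, x⁆ - c • ⁅s', x⁆ := by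
      simp only [add_lie, lie_add, lie_smul, smul_lie, lie_self, ← lie_skew s' x]
      module
    have e' : σ ⁅s, s'⁆ m = σ s (σ s' m) - σ s' (σ s m) := by
      rw [hσS _ (hS s hs s' hs'), hσS s hs, hσS s' hs', hσS s' hs', hσS s hs]
      exact hrep s hs s' hs' m
    rw [e]
    simp only [map_add, map_sub, map_smul, LinearMap.add_apply, LinearMap.sub_apply,
      LinearMap.smul_apply, e', hσδ s hs, hσδ s' hs']
    module
  · intro s hs v
    rw [hσS s hs]
    simp [stepAct_single_zero]

/-- Passing to the union of an increasing chain: the extended module consists of the sequences in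
the product of the given modules, taken modulo sequences that are eventually zero. -/
theorem Extends.iSup_of_monotone {S : Submodule K L} {T : ℕ → Submodule K L} (hT : Monotone T)
    (h : ∀ n, Extends.{u, v, w} S (T n)) :
    Extends.{u, v, w} S (⨆ n, T n) := by
  intro V _ _ ρ hρ
  choose M _ _ σ j hσ hj hjs using fun n => h n V ρ hρ
  let Z : Submodule K (∀ n, M n) :=
    { carrier := {f | ∃ N, ∀ n, N ≤ n → f n = 0}
      add_mem' := by
        rintro f g ⟨N, hN⟩ ⟨N', hN'⟩
        exact ⟨max N N', fun n hn => by
          simp [hN n (le_of_max_le_left hn), hN' n (le_of_max_le_right hn)]⟩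
      zero_mem' := ⟨0, fun _ _ => rfl⟩
      smul_mem' := by
        rintro c f ⟨N, hN⟩
        exact ⟨N, fun n hn => by simp [hN n hn]⟩ }
  let τ₀ : L → Module.End K (∀ n, M n) := fun y =>
    LinearMap.pi fun n => σ n y ∘ₗ LinearMap.proj n
  have hτ₀ : ∀ y, Z ≤ Z.comap (τ₀ y) := by
    rintro y f ⟨N, hN⟩
    exact ⟨N, fun n hn => by simp [τ₀, hN n hn]⟩
  let τ : L →ₗ[K] Module.End K ((∀ n, M n) ⧸ Z) :=
    { toFun := fun y => Z.mapQ Z (τ₀ y) (hτ₀ y)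
      map_add' := fun y y' => by
        ext f
        simp only [LinearMap.coe_comp, Function.comp_apply, Submodule.mkQ_apply,
          Submodule.mapQ_apply, LinearMap.add_apply, ← Submodule.Quotient.mk_add]
        congr 1
        ext n
        simp [τ₀]
      map_smul' := fun c y => by
        ext f
        simp only [LinearMap.coe_comp, Function.comp_apply, Submodule.mkQ_apply,
          Submodule.mapQ_apply, LinearMap.smul_apply, RingHom.id_apply,
          ← Submodule.Quotient.mk_smul]
        congr 1
        ext n
        simp [τ₀] }
  have hτ : ∀ y f, τ y (Submodule.Quotient.mk f) = Submodule.Quotient.mk (τ₀ y f) :=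
    fun _ _ => rfl
  refine ⟨(∀ n, M n) ⧸ Z, inferInstance, inferInstance, τ, Z.mkQ ∘ₗ LinearMap.pi j, ?_, ?_, ?_⟩
  · intro x hx y hy m
    obtain ⟨N, hN⟩ := (Submodule.mem_iSup_of_directed T hT.directed_le).1 hx
    obtain ⟨N', hN'⟩ := (Submodule.mem_iSup_of_directed T hT.directed_le).1 hy
    obtain ⟨f, rfl⟩ := Submodule.Quotient.mk_surjective Z m
    rw [hτ, hτ, hτ, hτ, hτ, ← Submodule.Quotient.mk_sub, Submodule.Quotient.eq]
    refine ⟨max N N', fun n hn => ?_⟩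
    simp [τ₀, hσ n x (hT (le_of_max_le_left hn) hN) y (hT (le_of_max_le_right hn) hN')]
  · rw [← LinearMap.ker_eq_bot, LinearMap.ker_eq_bot']
    intro v hv
    obtain ⟨N, hN⟩ := (Submodule.Quotient.mk_eq_zero Z).1 hv
    exact (map_eq_zero_iff (j N) (hj N)).1 (hN N le_rfl)
  · intro s hs v
    simp only [LinearMap.coe_comp, Function.comp_apply, Submodule.mkQ_apply, hτ]
    congr 1
    ext n
    simp [τ₀, hjs n s hs]

end LiePartialRep

/-! ### Embedding a module into the induced module -/

namespace LieInduced

attribute [local instance 100] LieRing.ofAssociativeRing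

section Gen

variable {R L : Type*} [CommRing R] [LieRing L] [LieAlgebra R L]

/-- Induction on the enveloping algebra: it is generated by the image of the Lie algebra. -/
theorem env_induction {C : UniversalEnvelopingAlgebra R L → Prop}
    (halg : ∀ r, C (algebraMap R _ r)) (hι : ∀ x, C (UniversalEnvelopingAlgebra.ι R x))
    (hadd : ∀ a b, C a → C b → C (a + b)) (hmul : ∀ a b, C a → C b → C (a * b))
    (a : UniversalEnvelopingAlgebra R L) : C a := by
  let B : Subalgebra R (UniversalEnvelopingAlgebra R L) :=
    { carrier := {a | C a}
      mul_mem' := fun {a b} ha hb => hmul a b ha hb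
      add_mem' := fun {a b} ha hb => hadd a b ha hb
      algebraMap_mem' := halg }
  let f : L →ₗ⁅R⁆ B :=
    { toFun := fun x => ⟨UniversalEnvelopingAlgebra.ι R x, hι x⟩
      map_add' := fun x y => by ext; simp
      map_smul' := fun c x => by ext; simp
      map_lie' := fun {x y} => by ext; simp [LieRing.of_associative_ring_bracket] }
  have h : B.val.comp (UniversalEnvelopingAlgebra.lift R f) = AlgHom.id R _ := by
    apply UniversalEnvelopingAlgebra.hom_ext
    ext x
    simp only [LieHom.coe_comp, Function.comp_apply, AlgHom.coe_toLieHom, AlgHom.coe_comp,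
      UniversalEnvelopingAlgebra.lift_ι_apply, AlgHom.coe_id, id_eq]
    rfl
  have h' := congrArg (fun g => g a) h
  simp only [AlgHom.coe_comp, Function.comp_apply, AlgHom.coe_id, id_eq] at h'
  rw [← h']
  exact (UniversalEnvelopingAlgebra.lift R f a).2

variable (S : LieSubalgebra R L) (V : Type*) [AddCommGroup V] [Module R V] [LieRingModule S V]
  [LieModule R S V]

/-- The canonical map `v ↦ 1 ⊗ v` from a module to the induced module. -/
def incl : V →ₗ[R] LieInduced S V :=
  ((balanced S V).mkQ.restrictScalars R) ∘ₗ TensorProduct.mk R (UniversalEnvelopingAlgebra R L) V 1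

theorem smul_incl (u : UniversalEnvelopingAlgebra R L) (v : V) :
    u • incl S V v = (balanced S V).mkQ (u ⊗ₜ v) := by
  change u • (balanced S V).mkQ (1 ⊗ₜ v) = _
  rw [← map_smul, TensorProduct.smul_tmul', smul_eq_mul, mul_one]

theorem lie_incl (s : S) (v : V) : ⁅(s : L), incl S V v⁆ = incl S V ⁅s, v⁆ := by
  rw [lie_def, smul_incl]
  change _ = (balanced S V).mkQ (1 ⊗ₜ _)
  rw [← sub_eq_zero, ← map_sub, Submodule.mkQ_apply, Submodule.Quotient.mk_eq_zero]
  refine Submodule.subset_span ⟨1, UniversalEnvelopingAlgebra.ι R s, v, ?_⟩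
  simp [envMap, envAct]

/-- The induced module is generated by the image of the original module. -/
theorem induction {C : LieInduced S V → Prop} (hincl : ∀ v, C (incl S V v))
    (hadd : ∀ x y, C x → C y → C (x + y)) (hsmul : ∀ (c : R) x, C x → C (c • x))
    (hlie : ∀ (x : L) m, C m → C ⁅x, m⁆) (m : LieInduced S V) : C m := by
  have hC : ∀ (u : UniversalEnvelopingAlgebra R L) m, C m → C (u • m) := by
    intro u
    induction u using env_induction with
    | halg r => intro m hm; rw [algebraMap_smul]; exact hsmul r m hm
    | hι x => exact fun m hm => hlie x m hm
    | hadd a b ha hb => intro m hm; rw [add_smul]; exact hadd _ _ (ha m hm) (hb m hm)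
    | hmul a b ha hb => intro m hm; rw [mul_smul]; exact ha _ (hb m hm)
  obtain ⟨t, rfl⟩ := (balanced S V).mkQ_surjective m
  induction t using TensorProduct.induction_on with
  | zero =>
    have h := hincl 0
    rw [map_zero] at h
    exact h
  | tmul u v => rw [← smul_incl]; exact hC u _ (hincl v)
  | add x y hx hy => rw [map_add]; exact hadd _ _ hx hy

end Gen

open LiePartialRep

universe u v w

/-- If every representation on the subalgebra `S` extends to all of `L`, then a module over `S`
embeds into its induced module. -/
theorem incl_injective {K : Type u} {L : Type v} [Field K] [LieRing L] [LieAlgebra K L]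
    (S : LieSubalgebra K L) (hS : Extends.{u, v, w} S.toSubmodule ⊤)
    (V : Type w) [AddCommGroup V] [Module K V] [LieRingModule S V] [LieModule K S V] :
    Function.Injective (incl S V) := by
  obtain ⟨ρ, hρ⟩ := LinearMap.exists_extend (p := S.toSubmodule)
    (LieModule.toEnd K S V : S →ₗ[K] Module.End K V)
  have hρ' : ∀ s : S, ∀ v, ρ s v = ⁅s, v⁆ := fun s v =>
    congrArg (fun g : S →ₗ[K] Module.End K V => g s v) hρ
  obtain ⟨M, _, _, σ, j, hσ, hj, hjs⟩ := hS V ρ (by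
    intro x hx y hy v
    have h1 := hρ' ⁅(⟨x, hx⟩ : S), ⟨y, hy⟩⁆ v
    rw [LieSubalgebra.coe_bracket] at h1
    have h2 := hρ' ⟨x, hx⟩
    have h3 := hρ' ⟨y, hy⟩
    simp only at h1 h2 h3
    rw [h1, h2, h3, h2, h3, lie_lie])
  let f : L →ₗ⁅K⁆ Module.End K M :=
    { σ with
      map_lie' := fun {x y} => by
        ext m
        simpa [LieRing.of_associative_ring_bracket] using hσ x trivial y trivial m }
  let F := UniversalEnvelopingAlgebra.lift K f
  have hF : ∀ x, F (UniversalEnvelopingAlgebra.ι K x) = σ x := fun x =>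
    UniversalEnvelopingAlgebra.lift_ι_apply K f x
  have hcompat : ∀ (a : UniversalEnvelopingAlgebra K S) (v : V),
      F (envMap S a) (j v) = j (envAct S V a v) := by
    intro a
    induction a using env_induction with
    | halg r => intro v; simp
    | hι x =>
      intro v
      rw [envMap, envAct, UniversalEnvelopingAlgebra.lift_ι_apply,
        UniversalEnvelopingAlgebra.lift_ι_apply]
      change F (UniversalEnvelopingAlgebra.ι K (x : L)) (j v) = j ⁅x, v⁆
      rw [hF, ← hjs _ x.2, hρ']
    | hadd a b ha hb => intro v; simp [ha, hb]
    | hmul a b ha hb => intro v; simp [ha, hb]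
  let Φ : (UniversalEnvelopingAlgebra K L ⊗[K] V) →ₗ[K] M :=
    TensorProduct.lift (((LinearMap.lcomp K M j) : _ →ₗ[K] V →ₗ[K] M) ∘ₗ F.toLinearMap)
  have hΦ : ∀ u v, Φ (u ⊗ₜ v) = F u (j v) := fun u v => by simp [Φ]
  have hΦs : ∀ (a : UniversalEnvelopingAlgebra K L) t, Φ (a • t) = F a (Φ t) := by
    intro a t
    induction t using TensorProduct.induction_on with
    | zero => simp
    | tmul u v => simp [TensorProduct.smul_tmul', hΦ]
    | add x y hx hy => rw [smul_add, map_add, hx, hy, map_add, map_add]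
  have hbal : ∀ t ∈ balanced S V, Φ t = 0 := by
    intro t ht
    induction ht using Submodule.span_induction with
    | mem x hx =>
      obtain ⟨u, a, v, rfl⟩ := hx
      rw [map_sub, hΦ, hΦ, map_mul, Module.End.mul_apply, hcompat, sub_self]
    | zero => simp
    | add x y _ _ hx hy => rw [map_add, hx, hy, add_zero]
    | smul a x _ hx => rw [hΦs, hx, map_zero]
  rw [← LinearMap.ker_eq_bot, LinearMap.ker_eq_bot']
  intro v hv
  have h0 := hbal (1 ⊗ₜ v) ((Submodule.Quotient.mk_eq_zero _).1 hv)
  rw [hΦ, map_one, Module.End.one_apply] at h0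
  exact (map_eq_zero_iff j hj).1 h0

end LieInduced

/-! ### Brackets of basis vectors and the subspaces they span -/

namespace AffineAge

/-- The scalar in `[a, b] = lieCoef a b • lieGen a b` for basis vectors `a, b` of `age(1)`. -/
def lieCoef : AgeGen → AgeGen → ℂ
  | .h, .e => 2
  | .e, .h => -2
  | .h, .p => 1
  | .p, .h => -1
  | .h, .q => -1
  | .q, .h => 1
  | .e, .q => 1
  | .q, .e => -1
  | .p, .q => 1
  | .q, .p => -1
  | _, _ => 0

/-- The basis vector in `[a, b] = lieCoef a b • lieGen a b`; it is `z` where the bracket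
vanishes. -/
def lieGen : AgeGen → AgeGen → AgeGen
  | .h, .e | .e, .h => .e
  | .h, .p | .p, .h | .e, .q | .q, .e => .p
  | .h, .q | .q, .h => .q
  | _, _ => .z

theorem lie_gen_gen (a b : AgeGen) :
    ⁅Age.gen a, Age.gen b⁆ = lieCoef a b • Age.gen (lieGen a b) := by
  ext g
  cases a <;> cases b <;> cases g <;> simp [Age.bracket_apply, Age.gen, lieCoef, lieGen]

theorem lie_basis (a b : AgeGen) (m n : ℤ) :
    ⁅mode (Age.gen a) m, mode (Age.gen b) n⁆ =
      lieCoef a b • mode (Age.gen (lieGen a b)) (m + n) +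
        (if m + n = 0 then (m : ℂ) * Age.form (Age.gen a) (Age.gen b) else 0) • k := by
  rw [lie_mode_mode, lie_gen_gen, mode_smul]

theorem form_gen_of_ne {a b : AgeGen} (h : ¬(a = .h ∧ b = .h)) :
    Age.form (Age.gen a) (Age.gen b) = 0 := by
  cases a <;> cases b <;> simp_all [Age.gen]

theorem mode_add (α β : Age) (n : ℤ) : mode (α + β) n = mode α n + mode β n := by
  rw [mode, mode, mode, ← LieAlgebra.of_add, TensorProduct.tmul_add, Prod.mk_add_mk, add_zero]

/-- The subspace of the affine ageing algebra spanned by `k` and the basis modes `g_n` with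
`B g n`. -/
def modeSpan (B : AgeGen → ℤ → Prop) : Submodule ℂ AffineAge :=
  Submodule.span ℂ ({x | ∃ g n, B g n ∧ x = mode (Age.gen g) n} ∪ {k})

theorem mode_mem_modeSpan {B : AgeGen → ℤ → Prop} {g : AgeGen} {n : ℤ} (h : B g n) :
    mode (Age.gen g) n ∈ modeSpan B :=
  Submodule.subset_span (.inl ⟨g, n, h, rfl⟩)

theorem k_mem_modeSpan (B : AgeGen → ℤ → Prop) : k ∈ modeSpan B :=
  Submodule.subset_span (.inr rfl)

theorem modeSpan_le {B : AgeGen → ℤ → Prop} {T : Submodule ℂ AffineAge}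
    (h : ∀ g n, B g n → mode (Age.gen g) n ∈ T) (hk : k ∈ T) : modeSpan B ≤ T := by
  refine Submodule.span_le.2 ?_
  rintro x (⟨g, n, hB, rfl⟩ | rfl)
  · exact h g n hB
  · exact hk

theorem modeSpan_mono {B B' : AgeGen → ℤ → Prop} (h : ∀ g n, B g n → B' g n) :
    modeSpan B ≤ modeSpan B' :=
  modeSpan_le (fun g n hB => mode_mem_modeSpan (h g n hB)) (k_mem_modeSpan B')

theorem modeSpan_true : modeSpan (fun _ _ => True) = ⊤ := by
  set T := modeSpan (fun _ _ => True)
  have hmode : ∀ (α : Age) (n : ℤ), mode α n ∈ T := by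
    intro α n
    have hα : α = α .e • Age.gen .e + α .h • Age.gen .h + α .p • Age.gen .p + α .q • Age.gen .q +
        α .z • Age.gen .z := by
      ext g; cases g <;> simp [Age.gen]
    rw [hα]
    simp only [mode_add, mode_smul]
    have hg : ∀ g, mode (Age.gen g) n ∈ T := fun g => mode_mem_modeSpan trivial
    exact T.add_mem (T.add_mem (T.add_mem (T.add_mem (T.smul_mem _ (hg _)) (T.smul_mem _ (hg _)))
      (T.smul_mem _ (hg _))) (T.smul_mem _ (hg _))) (T.smul_mem _ (hg _))
  have hloop : ∀ f : ℤ →₀ Age, LieAlgebra.ofProd ageCocycle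
      ((LieAlgebra.LoopAlgebra.toFinsupp ℂ ℤ Age).symm f, 0) ∈ T := by
    intro f
    induction f using Finsupp.induction_linear with
    | zero => rw [map_zero]; exact T.zero_mem
    | add f g hf hg =>
      have h := T.add_mem hf hg
      rw [← LieAlgebra.of_add, Prod.mk_add_mk, add_zero, ← map_add] at h
      exact h
    | single n α => rw [LieAlgebra.LoopAlgebra.toFinsupp_symm_single]; exact hmode α n
  refine eq_top_iff.2 fun x _ => ?_
  obtain ⟨⟨f, c⟩, rfl⟩ := (LieAlgebra.ofProd ageCocycle).surjective x
  have h1 := hloop (LieAlgebra.LoopAlgebra.toFinsupp ℂ ℤ Age f)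
  rw [LinearEquiv.symm_apply_apply] at h1
  have h2 := T.smul_mem (TrivialLieModule.equiv ℂ _ ℂ c) (k_mem_modeSpan fun _ _ => True)
  have h3 := T.add_mem h1 h2
  rw [k, ← LieAlgebra.of_smul, ← LieAlgebra.of_add] at h3
  convert h3 using 2
  rw [Prod.smul_mk, Prod.mk_add_mk, smul_zero, add_zero, zero_add, ← map_smul, smul_eq_mul,
    mul_one, LinearEquiv.symm_apply_apply]

/-- The coordinate of an element of the affine ageing algebra at the mode `g_n`. -/
def coord (g : AgeGen) (n : ℤ) : AffineAge →ₗ[ℂ] ℂ where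
  toFun x := LieAlgebra.LoopAlgebra.toFinsupp ℂ ℤ Age ((LieAlgebra.ofProd ageCocycle).symm x).1 n g
  map_add' x y := by simp
  map_smul' c x := by simp

theorem coord_mode (g g' : AgeGen) (n n' : ℤ) :
    coord g n (mode (Age.gen g') n') = if n' = n ∧ g = g' then 1 else 0 := by
  simp only [coord, mode, LinearMap.coe_mk, AddHom.coe_mk, Equiv.symm_apply_apply,
    LieAlgebra.LoopAlgebra.toFinsupp_single_tmul, Finsupp.single_apply]
  by_cases h : n' = n <;> simp [h, Age.gen]

theorem coord_k (g : AgeGen) (n : ℤ) : coord g n k = 0 := by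
  simp [coord, k]

theorem mode_mem_modeSpan_iff {B : AgeGen → ℤ → Prop} {g : AgeGen} {n : ℤ} :
    mode (Age.gen g) n ∈ modeSpan B ↔ B g n := by
  refine ⟨fun h => ?_, mode_mem_modeSpan⟩
  by_contra hB
  have hle : modeSpan B ≤ LinearMap.ker (coord g n) := by
    refine modeSpan_le (fun g' n' hB' => ?_) (coord_k g n)
    rw [LinearMap.mem_ker, coord_mode, if_neg]
    rintro ⟨rfl, rfl⟩
    exact hB hB'
  have h1 := hle h
  rw [LinearMap.mem_ker, coord_mode, if_pos ⟨rfl, rfl⟩] at h1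
  exact one_ne_zero h1

theorem lie_mem_of_modeSpan {B B' : AgeGen → ℤ → Prop} {T : Submodule ℂ AffineAge} (hk : k ∈ T)
    (h : ∀ a m b n, B a m → B' b n → lieCoef a b ≠ 0 → mode (Age.gen (lieGen a b)) (m + n) ∈ T)
    {x y : AffineAge} (hx : x ∈ modeSpan B) (hy : y ∈ modeSpan B') : ⁅x, y⁆ ∈ T := by
  induction hx, hy using Submodule.span_induction₂ with
  | mem_mem x y hx hy =>
    obtain ⟨a, m, ha, rfl⟩ | rfl := hx
    · obtain ⟨b, n, hb, rfl⟩ | rfl := hy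
      · rw [lie_basis]
        refine T.add_mem ?_ (T.smul_mem _ hk)
        by_cases hc : lieCoef a b = 0
        · rw [hc, zero_smul]; exact T.zero_mem
        · exact T.smul_mem _ (h a m b n ha hb hc)
      · rw [lie_k]; exact T.zero_mem
    · rw [k_lie]; exact T.zero_mem
  | zero_left y hy => rw [zero_lie]; exact T.zero_mem
  | zero_right x hx => rw [lie_zero]; exact T.zero_mem
  | add_left x y z _ _ _ h₁ h₂ => rw [add_lie]; exact T.add_mem h₁ h₂
  | add_right x y z _ _ _ h₁ h₂ => rw [lie_add]; exact T.add_mem h₁ h₂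
  | smul_left c x y _ _ h => rw [smul_lie]; exact T.smul_mem _ h
  | smul_right c x y _ _ h => rw [lie_smul]; exact T.smul_mem _ h

/-- The modes spanning, together with `k`, the subalgebra `sub d₁ d₂ d₃`. -/
def SubMode (d₁ d₂ d₃ : ℤ) : AgeGen → ℤ → Prop
  | .e, n => d₁ ≤ n
  | .h, n => 0 ≤ n
  | .p, n => d₂ ≤ n
  | .q, n => d₃ ≤ n
  | .z, _ => True

theorem sub_toSubmodule (d₁ d₂ d₃ : ℤ) (hd : d₂ ≤ d₁ + d₃) :
    (sub d₁ d₂ d₃ hd).toSubmodule = modeSpan (SubMode d₁ d₂ d₃) := by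
  refine le_antisymm (Submodule.span_le.2 fun x hx => ?_)
    (modeSpan_le (fun g n hB => Submodule.subset_span (SubGen.mode_mem g n ?_))
      (Submodule.subset_span .k))
  · obtain rfl | ⟨g, n, rfl, h⟩ := SubGen.cases_mode hx
    · exact k_mem_modeSpan _
    · exact mode_mem_modeSpan (by cases g <;> exact h)
  · cases g <;> exact hB

theorem mode_mem_sub_iff {d₁ d₂ d₃ : ℤ} {hd : d₂ ≤ d₁ + d₃} {g : AgeGen} {n : ℤ} :
    mode (Age.gen g) n ∈ sub d₁ d₂ d₃ hd ↔ SubMode d₁ d₂ d₃ g n := by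
  rw [← LieSubalgebra.mem_toSubmodule, sub_toSubmodule, mode_mem_modeSpan_iff]

theorem k_mem_sub (d₁ d₂ d₃ : ℤ) (hd : d₂ ≤ d₁ + d₃) : k ∈ sub d₁ d₂ d₃ hd :=
  Submodule.subset_span .k

/-! ### Extending representations to the whole affine ageing algebra -/

open LiePartialRep

universe w

/-- Adjoining a single mode `g_n` to a subalgebra spanned by modes. -/
theorem extends_adjoin {B B' : AgeGen → ℤ → Prop} (g : AgeGen) (n : ℤ)
    (hB : ∀ a m b n, B a m → B b n → lieCoef a b ≠ 0 → B (lieGen a b) (m + n))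
    (hg : ∀ a m, B a m → lieCoef a g ≠ 0 →
      B (lieGen a g) (m + n) ∨ lieGen a g = g ∧ m + n = n)
    (hB' : ∀ a m, B' a m → B a m ∨ a = g ∧ m = n) :
    Extends.{0, 0, w} (modeSpan B) (modeSpan B') := by
  have hx : mode (Age.gen g) n ∈ modeSpan B ⊔ Submodule.span ℂ {mode (Age.gen g) n} :=
    Submodule.mem_sup_right (Submodule.mem_span_singleton_self _)
  refine (Extends.sup_span_singleton (x := mode (Age.gen g) n) (fun s hs s' hs' => ?_)
    fun s hs => ?_).mono (modeSpan_le (fun a m h => ?_) ?_)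
  · exact lie_mem_of_modeSpan (k_mem_modeSpan B)
      (fun a m b n ha hb hc => mode_mem_modeSpan (hB a m b n ha hb hc)) hs hs'
  · refine lie_mem_of_modeSpan (B' := fun a m => a = g ∧ m = n)
      (Submodule.mem_sup_left (k_mem_modeSpan B)) ?_ hs (mode_mem_modeSpan ⟨rfl, rfl⟩)
    rintro a m b n' ha ⟨rfl, rfl⟩ hc
    obtain h | ⟨h1, h2⟩ := hg a m ha hc
    · exact Submodule.mem_sup_left (mode_mem_modeSpan h)
    · rwa [h1, h2]
  · obtain h' | ⟨rfl, rfl⟩ := hB' a m h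
    · exact Submodule.mem_sup_left (mode_mem_modeSpan h')
    · exact hx
  · exact Submodule.mem_sup_left (k_mem_modeSpan B)

theorem extends_of_chain {B : ℕ → AgeGen → ℤ → Prop} {B' : AgeGen → ℤ → Prop}
    (hmono : ∀ i g n, B i g n → B (i + 1) g n)
    (hstep : ∀ i, Extends.{0, 0, w} (modeSpan (B i)) (modeSpan (B (i + 1))))
    (hB' : ∀ g n, B' g n → ∃ i, B i g n) :
    Extends.{0, 0, w} (modeSpan (B 0)) (modeSpan B') := by
  have hm : Monotone fun i => modeSpan (B i) :=
    monotone_nat_of_le_succ fun i => modeSpan_mono (hmono i)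
  refine (Extends.iSup_of_monotone hm fun i => ?_).mono (modeSpan_le (fun g n h => ?_) ?_)
  · induction i with
    | zero => exact Extends.refl _
    | succ i ih => exact ih.trans (hstep i) (hm (Nat.zero_le i))
  · obtain ⟨i, hi⟩ := hB' g n h
    exact Submodule.mem_iSup_of_mem i (mode_mem_modeSpan hi)
  · exact Submodule.mem_iSup_of_mem 0 (k_mem_modeSpan _)

theorem subMode_lie {d₁ d₂ d₃ : ℤ} (hd : d₂ ≤ d₁ + d₃) (a : AgeGen) (m : ℤ) (b : AgeGen) (n : ℤ)
    (ha : SubMode d₁ d₂ d₃ a m) (hb : SubMode d₁ d₂ d₃ b n) (hc : lieCoef a b ≠ 0) :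
    SubMode d₁ d₂ d₃ (lieGen a b) (m + n) := by
  cases a <;> cases b <;> simp_all [SubMode, lieCoef, lieGen] <;> omega

theorem extends_p {d₁ d₂ d₃ : ℤ} (hd : d₂ ≤ d₁ + d₃) :
    Extends.{0, 0, w} (modeSpan (SubMode d₁ d₂ d₃)) (modeSpan (SubMode d₁ (d₂ - 1) d₃)) := by
  refine extends_adjoin .p (d₂ - 1) (subMode_lie hd) (fun a m ha hc => ?_) fun a m ha => ?_
  · cases a <;> simp_all [SubMode, lieCoef, lieGen]
    omega
  · cases a <;> simp_all [SubMode]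
    omega

theorem extends_e {d₁ d₂ d₃ : ℤ} (hd : d₂ ≤ d₁ - 1 + d₃) :
    Extends.{0, 0, w} (modeSpan (SubMode d₁ d₂ d₃)) (modeSpan (SubMode (d₁ - 1) d₂ d₃)) := by
  refine extends_adjoin .e (d₁ - 1) (subMode_lie (by omega)) (fun a m ha hc => ?_) fun a m ha => ?_
  · cases a <;> simp_all [SubMode, lieCoef, lieGen] <;> omega
  · cases a <;> simp_all [SubMode]
    omega

theorem extends_q {d₁ d₂ d₃ : ℤ} (hd : d₂ ≤ d₁ + (d₃ - 1)) :
    Extends.{0, 0, w} (modeSpan (SubMode d₁ d₂ d₃)) (modeSpan (SubMode d₁ d₂ (d₃ - 1))) := by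
  refine extends_adjoin .q (d₃ - 1) (subMode_lie (by omega)) (fun a m ha hc => ?_) fun a m ha => ?_
  · cases a <;> simp_all [SubMode, lieCoef, lieGen] <;> omega
  · cases a <;> simp_all [SubMode]
    omega

/-- Every representation of `sub d₁ d₂ d₃` embeds into a representation of the affine ageing
algebra. The modes of `e, p, q` are adjoined before those of `h`: bracketing with a negative mode of
`h` lowers the index of every other mode. -/
theorem extends_top {d₁ d₂ d₃ : ℤ} (hd : d₂ ≤ d₁ + d₃) :
    Extends.{0, 0, w} (modeSpan (SubMode d₁ d₂ d₃)) ⊤ := by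
  have h1 : Extends.{0, 0, w} (modeSpan (SubMode d₁ d₂ d₃))
      (modeSpan fun g n => g = .h → 0 ≤ n) := by
    have h := extends_of_chain.{w}
      (B := fun i : ℕ => SubMode (d₁ - i) (d₂ - 2 * i) (d₃ - i))
      (B' := fun g n => g = .h → 0 ≤ n) (fun i g n h => ?_) (fun i => ?_) (fun g n h => ?_)
    · simpa using h
    · cases g <;> simp only [SubMode] at h ⊢ <;> push_cast <;> omega
    · have e : SubMode (d₁ - (i + 1 : ℕ)) (d₂ - 2 * (i + 1 : ℕ)) (d₃ - (i + 1 : ℕ)) =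
          SubMode (d₁ - i - 1) (d₂ - 2 * i - 1 - 1) (d₃ - i - 1) := by
        congr 1 <;> push_cast <;> ring
      have m1 : ∀ {a b c a' b' c' : ℤ}, a' ≤ a → b' ≤ b → c' ≤ c →
          modeSpan (SubMode a b c) ≤ modeSpan (SubMode a' b' c') := by
        intro a b c a' b' c' ha hb hc
        refine modeSpan_mono fun g n h => ?_
        cases g <;> simp only [SubMode] at h ⊢ <;> omega
      rw [e]
      refine (((extends_p ?_).trans (extends_p ?_) (m1 ?_ ?_ ?_)).trans (extends_e ?_)
        (m1 ?_ ?_ ?_)).trans (extends_q ?_) (m1 ?_ ?_ ?_) <;> omega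
    · refine ⟨(|d₁| + |d₂| + |d₃| + |n|).toNat, ?_⟩
      have h1 := neg_abs_le n
      have h2 := neg_abs_le d₂
      have h3 := neg_abs_le d₁
      have h4 := neg_abs_le d₃
      have h5 := le_abs_self d₁
      have h6 := le_abs_self d₂
      have h7 := le_abs_self d₃
      cases g <;> simp only [SubMode] <;> first | omega | exact h rfl
  have h2 : Extends.{0, 0, w} (modeSpan fun g n => g = .h → 0 ≤ n) ⊤ := by
    have h := extends_of_chain.{w} (B := fun (i : ℕ) g n => g = .h → -(i : ℤ) ≤ n)
      (B' := fun _ _ => True) (fun i g n h hg => ?_) (fun i => ?_) (fun g n _ => ?_)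
    · simpa [modeSpan_true] using h
    · have := h hg; push_cast; omega
    · refine extends_adjoin .h (-(i : ℤ) - 1) (fun a m b n _ _ hc => ?_) (fun a m _ hc => ?_)
        fun a m ha => ?_
      · cases a <;> cases b <;> simp_all [lieCoef, lieGen]
      · cases a <;> simp_all [lieCoef, lieGen]
      · by_cases hh : a = .h
        · have := ha hh
          simp only [hh, forall_const, true_and]
          push_cast at this
          omega
        · exact .inl fun h => absurd h hh
    · exact ⟨n.natAbs, fun _ => by omega⟩
  refine h1.trans h2 (modeSpan_mono fun g n h hg => ?_)
  subst hg
  exact h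

end AffineAge

/-! ### Words in lowering elements and their leading terms -/

namespace LoweringWords

variable {K L M V ι : Type*} [Field K] [LieRing L] [LieAlgebra K L]
  [AddCommGroup M] [Module K M] [LieRingModule L M] [LieModule K L M]
  [AddCommGroup V] [Module K V]

section Basic

variable (b : ι → L) (j : V →ₗ[K] M) (wt : ι → ℤ)

/-- The map `v ↦ b i₁ ⋯ b iᵣ (j v)` attached to the word `i₁, …, iᵣ`. -/
def word (l : List ι) : V →ₗ[K] M :=
  l.foldr (fun i f => (LieModule.toEnd K L M (b i)) ∘ₗ f) j

@[simp] theorem word_nil (v : V) : word b j [] v = j v := rfl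

@[simp] theorem word_cons (i : ι) (l : List ι) (v : V) :
    word b j (i :: l) v = ⁅b i, word b j l v⁆ := rfl

/-- The span of all `word l v` in which the word `l` has weight at most `D`. -/
def filt (D : ℤ) : Submodule K M :=
  Submodule.span K {x | ∃ (l : List ι) (v : V), (l.map wt).sum ≤ D ∧ x = word b j l v}

variable {b j wt}

theorem word_mem_filt {l : List ι} {D : ℤ} (h : (l.map wt).sum ≤ D) (v : V) :
    word b j l v ∈ filt b j wt D :=
  Submodule.subset_span ⟨l, v, h, rfl⟩

theorem filt_mono {D D' : ℤ} (h : D ≤ D') : filt b j wt D ≤ filt b j wt D' := by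
  refine Submodule.span_le.2 ?_
  rintro x ⟨l, v, hl, rfl⟩
  exact word_mem_filt (hl.trans h) v

/-- To bound the effect of `x` on the filtration it suffices to look at words. -/
theorem lie_mem_filt {x : L} {r : ℤ}
    (h : ∀ l v, ⁅x, word b j l v⁆ ∈ filt b j wt ((l.map wt).sum + r)) {D : ℤ} {m : M}
    (hm : m ∈ filt b j wt D) : ⁅x, m⁆ ∈ filt b j wt (D + r) := by
  induction hm using Submodule.span_induction with
  | mem m hm =>
    obtain ⟨l, v, hl, rfl⟩ := hm
    exact filt_mono (by omega) (h l v)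
  | zero => rw [lie_zero]; exact Submodule.zero_mem _
  | add m m' _ _ h h' => rw [lie_add]; exact Submodule.add_mem _ h h'
  | smul c m _ h => rw [lie_smul]; exact Submodule.smul_mem _ _ h

theorem lie_lowering_mem_filt (i : ι) {D : ℤ} {m : M} (hm : m ∈ filt b j wt D) :
    ⁅b i, m⁆ ∈ filt b j wt (D + wt i) :=
  lie_mem_filt (fun l v => word_mem_filt (l := i :: l)
    (by rw [List.map_cons, List.sum_cons, add_comm]) v) hm

theorem filt_eq_bot (hpos : ∀ i, 0 < wt i) {D : ℤ} (hD : D < 0) : filt b j wt D = ⊥ := by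
  refine Submodule.span_eq_bot.2 ?_
  rintro x ⟨l, v, hl, rfl⟩
  have : 0 ≤ (l.map wt).sum := List.sum_nonneg fun a ha => by
    obtain ⟨i, -, rfl⟩ := List.mem_map.1 ha
    exact (hpos i).le
  omega

end Basic

variable {b c : ι → L} {j : V →ₗ[K] M} {wt : ι → ℤ} {P : L} {π : V →ₗ[K] V}

/-- Lowering elements `b i` of weight `wt i`, an element `P` preserving the image of `V`, and
detecting elements `c i`. Modulo terms of lower weight the `b i` commute with each other and with
`P`, and `c i` acts as the derivation taking `b i` to `P` and all other `b i'` to zero. -/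
structure IsDetected (b c : ι → L) (j : V →ₗ[K] M) (wt : ι → ℤ) (P : L) (π : V →ₗ[K] V) :
    Prop where
  wt_pos : ∀ i, 0 < wt i
  lie_P : ∀ v, ⁅P, j v⁆ = j (π v)
  injective : Function.Injective π
  lie_c : ∀ i v, ⁅c i, j v⁆ = 0
  c_mem : ∀ i D m, m ∈ filt b j wt D → ⁅c i, m⁆ ∈ filt b j wt (D - wt i)
  lie_cb_self : ∀ i, ⁅c i, b i⁆ = P
  lie_cb : ∀ i i', i ≠ i' → ∀ D m, m ∈ filt b j wt D →
    ⁅⁅c i, b i'⁆, m⁆ ∈ filt b j wt (D + wt i' - wt i - 1)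
  lie_bb : ∀ i i' D m, m ∈ filt b j wt D →
    ⁅⁅b i, b i'⁆, m⁆ ∈ filt b j wt (D + wt i + wt i' - 1)
  lie_Pb : ∀ i D m, m ∈ filt b j wt D → ⁅⁅P, b i⁆, m⁆ ∈ filt b j wt (D + wt i - 1)

namespace IsDetected

variable (H : IsDetected b c j wt P π)

include H in
theorem word_perm {l l' : List ι} (h : l.Perm l') (v : V) :
    word b j l v - word b j l' v ∈ filt b j wt ((l.map wt).sum - 1) := by
  induction h with
  | nil => simp
  | @cons i l l' _ ih =>
    rw [word_cons, word_cons, ← lie_sub]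
    refine filt_mono ?_ (lie_lowering_mem_filt i ih)
    rw [List.map_cons, List.sum_cons]
    omega
  | swap i i' l =>
    simp only [word_cons]
    rw [← lie_lie]
    refine filt_mono ?_ (H.lie_bb i' i _ _ (word_mem_filt (le_refl (l.map wt).sum) v))
    simp only [List.map_cons, List.sum_cons]
    omega
  | @trans l l' l'' h1 _ ih1 ih2 =>
    rw [← sub_add_sub_cancel _ (word b j l' v)]
    refine Submodule.add_mem _ ih1 ?_
    rwa [(h1.map wt).sum_eq]

include H in
theorem lie_P_word (l : List ι) (v : V) :
    ⁅P, word b j l v⁆ - word b j l (π v) ∈ filt b j wt ((l.map wt).sum - 1) := by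
  induction l with
  | nil => simp [H.lie_P]
  | cons i l ih =>
    rw [word_cons, word_cons, leibniz_lie, add_sub_assoc, ← lie_sub]
    rw [List.map_cons, List.sum_cons]
    exact Submodule.add_mem _
      (filt_mono (by omega) (H.lie_Pb i _ _ (word_mem_filt (le_refl (l.map wt).sum) v)))
      (filt_mono (by omega) (lie_lowering_mem_filt i ih))

variable (b j) in
/-- The element of `M` with a given formal leading term; the factors of each monomial are multiplied
in an arbitrary order. -/
def realize : (Multiset ι →₀ V) →ₗ[K] M :=
  Finsupp.lsum K fun m => word b j m.toList

@[simp] theorem realize_single (m : Multiset ι) (v : V) :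
    realize b j (Finsupp.single m v) = word b j m.toList v := by
  simp [realize]

include H in
/-- Every element of the filtration has a formal leading term. -/
theorem exists_realize {D : ℤ} {x : M} (hx : x ∈ filt b j wt D) :
    ∃ f : Multiset ι →₀ V, (∀ m ∈ f.support, (m.map wt).sum = D) ∧
      x - realize b j f ∈ filt b j wt (D - 1) := by
  induction hx using Submodule.span_induction with
  | mem x hx =>
    obtain ⟨l, v, hl, rfl⟩ := hx
    obtain hl | hl := hl.lt_or_eq
    · exact ⟨0, by simp, by simpa using word_mem_filt (by omega) v⟩
    · refine ⟨Finsupp.single (l : Multiset ι) v, fun m hm => ?_, ?_⟩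
      · rw [Finset.mem_singleton.1 (Finsupp.support_single_subset hm), Multiset.map_coe,
          Multiset.sum_coe, hl]
      · rw [realize_single, ← hl]
        exact H.word_perm (Multiset.coe_eq_coe.1 (Multiset.coe_toList _).symm) v
  | zero => exact ⟨0, by simp, by simp⟩
  | add x y _ _ hx hy =>
    classical
    obtain ⟨f, hf, hxf⟩ := hx
    obtain ⟨g, hg, hyg⟩ := hy
    refine ⟨f + g, fun m hm => ?_, ?_⟩
    · exact (Finset.mem_union.1 (Finsupp.support_add hm)).elim (hf m) (hg m)
    · rw [map_add, add_sub_add_comm]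
      exact Submodule.add_mem _ hxf hyg
  | smul a x _ hx =>
    obtain ⟨f, hf, hxf⟩ := hx
    refine ⟨a • f, fun m hm => hf m (Finsupp.support_smul hm), ?_⟩
    rw [map_smul, ← smul_sub]
    exact Submodule.smul_mem _ _ hxf

variable [DecidableEq ι]

include H in
/-- The detecting element `c i` acts on words, up to lower terms, by removing the letter `i`. -/
theorem lie_c_word (i : ι) (l : List ι) (v : V) :
    ⁅c i, word b j l v⁆ - (l.count i) • word b j (l.erase i) (π v) ∈
      filt b j wt ((l.map wt).sum - wt i - 1) := by
  induction l with
  | nil => simp [H.lie_c]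
  | cons a l ih =>
    have ih' := lie_lowering_mem_filt a ih
    rw [lie_sub, lie_nsmul, ← word_cons] at ih'
    rw [word_cons, leibniz_lie, List.map_cons, List.sum_cons]
    have hw := word_mem_filt (b := b) (j := j) (le_refl (l.map wt).sum) v
    by_cases hai : a = i
    · subst hai
      rw [List.erase_cons_head, List.count_cons_self, H.lie_cb_self]
      have h2 : (l.count a) • (word b j (a :: l.erase a) (π v) - word b j l (π v)) ∈
          filt b j wt ((l.map wt).sum - 1) := by
        by_cases hal : a ∈ l
        · have h3 := H.word_perm (List.perm_cons_erase hal) (π v)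
          exact Submodule.smul_of_tower_mem _ _ (sub_mem_comm_iff.1 h3)
        · rw [List.count_eq_zero_of_not_mem hal, zero_smul]
          exact Submodule.zero_mem _
      have h4 := Submodule.add_mem _ (Submodule.add_mem _ (H.lie_P_word l v) h2)
        (filt_mono (D' := (l.map wt).sum - 1) (by omega) ih')
      refine filt_mono (D := (l.map wt).sum - 1) (by omega) ?_
      convert h4 using 1
      module
    · rw [List.erase_cons_tail (by simpa using hai), List.count_cons_of_ne hai]
      have h1 := H.lie_cb i a (Ne.symm hai) _ _ hw
      have h2 := Submodule.add_mem _
        (filt_mono (D' := wt a + (l.map wt).sum - wt i - 1) (by omega) h1)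
        (filt_mono (D' := wt a + (l.map wt).sum - wt i - 1) (by omega) ih')
      rwa [← add_sub_assoc] at h2

variable (π) in
/-- The formal partial derivative with respect to `i`, combined with `π` on coefficients. -/
def formalDeriv (i : ι) : (Multiset ι →₀ V) →ₗ[K] (Multiset ι →₀ V) :=
  Finsupp.lsum K fun m => (m.count i) • (Finsupp.lsingle (m.erase i) ∘ₗ π)

theorem formalDeriv_apply (i : ι) (f : Multiset ι →₀ V) (m : Multiset ι) :
    formalDeriv π i f m = (m.count i + 1) • π (f (i ::ₘ m)) := by
  induction f using Finsupp.induction_linear with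
  | zero => simp
  | add f g hf hg => rw [map_add, Finsupp.add_apply, hf, hg, Finsupp.add_apply, map_add, smul_add]
  | single m' v =>
    have e : formalDeriv π i (Finsupp.single m' v) =
        (m'.count i) • Finsupp.single (m'.erase i) (π v) := by
      simp [formalDeriv]
    rw [e, Finsupp.smul_apply]
    by_cases h : m' = i ::ₘ m
    · subst h
      simp
    · rw [Finsupp.single_eq_of_ne (Ne.symm h), map_zero, smul_zero]
      by_cases hi : i ∈ m'
      · rw [Finsupp.single_eq_of_ne, smul_zero]
        rintro rfl
        exact h (Multiset.cons_erase hi).symm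
      · rw [Multiset.count_eq_zero_of_notMem hi, zero_smul]

include H in
theorem lie_c_realize (i : ι) {D : ℤ} (f : Multiset ι →₀ V)
    (hf : ∀ m ∈ f.support, (m.map wt).sum = D) :
    ⁅c i, realize b j f⁆ - realize b j (formalDeriv π i f) ∈ filt b j wt (D - wt i - 1) := by
  have e1 : realize b j f = ∑ m ∈ f.support, word b j m.toList (f m) := by
    simp [realize, Finsupp.sum]
  have e2 : realize b j (formalDeriv π i f) =
      ∑ m ∈ f.support, (m.count i) • word b j (m.erase i).toList (π (f m)) := by
    simp only [formalDeriv, Finsupp.lsum_apply, Finsupp.sum, map_sum]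
    refine Finset.sum_congr rfl fun m _ => ?_
    simp [map_nsmul]
  rw [e1, e2, lie_sum, ← Finset.sum_sub_distrib]
  refine Submodule.sum_mem _ fun m hm => ?_
  have hD : (m.toList.map wt).sum = D := by
    rw [← hf m hm, ← Multiset.sum_coe, ← Multiset.map_coe, Multiset.coe_toList]
  have h1 := H.lie_c_word i m.toList (f m)
  rw [hD] at h1
  have hcount : m.toList.count i = m.count i := by
    rw [← Multiset.coe_count, Multiset.coe_toList]
  rw [hcount] at h1
  by_cases hi : i ∈ m
  · have hperm : (m.toList.erase i).Perm (m.erase i).toList := by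
      rw [← Multiset.coe_eq_coe, Multiset.coe_toList, ← Multiset.coe_erase, Multiset.coe_toList]
    have h2 := H.word_perm hperm (π (f m))
    have hsum : ((m.toList.erase i).map wt).sum = D - wt i := by
      have := ((List.perm_cons_erase (Multiset.mem_toList.2 hi)).map wt).sum_eq
      rw [List.map_cons, List.sum_cons, hD] at this
      omega
    rw [hsum] at h2
    have h3 := Submodule.add_mem _ h1 (Submodule.smul_of_tower_mem _ (m.count i) h2)
    convert h3 using 1
    module
  · rw [Multiset.count_eq_zero_of_notMem hi, zero_smul] at h1 ⊢
    exact h1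

include H in
/-- An element with a nonzero formal leading term can be moved to a nonzero element of `V`: as long
as the monomial of some nonzero coefficient involves `i`, applying `c i` takes a formal derivative,
and the coefficient survives because `P` is injective and the characteristic is zero. -/
theorem exists_of_leading [CharZero K] (N : LieSubmodule K L M) :
    ∀ (n : ℕ) (D : ℤ) (f : Multiset ι →₀ V) (x : M), D.toNat ≤ n → f ≠ 0 →
      (∀ m ∈ f.support, (m.map wt).sum = D) → x - realize b j f ∈ filt b j wt (D - 1) →
      x ∈ N → ∃ v, v ≠ 0 ∧ j v ∈ N := by
  intro n
  induction n with
  | zero =>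
    intro D f x hD hf hfD hx hxN
    have hsupp : ∀ m ∈ f.support, m = 0 := by
      intro m hm
      by_contra hne
      obtain ⟨i, hi⟩ := Multiset.exists_mem_of_ne_zero hne
      have h1 := hfD m hm
      rw [← Multiset.cons_erase hi, Multiset.map_cons, Multiset.sum_cons] at h1
      have h2 : 0 ≤ ((m.erase i).map wt).sum := Multiset.sum_nonneg fun a ha => by
        obtain ⟨i', -, rfl⟩ := Multiset.mem_map.1 ha
        exact (H.wt_pos i').le
      have := H.wt_pos i
      omega
    obtain ⟨m, hm⟩ := Finsupp.support_nonempty_iff.2 hf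
    obtain rfl := hsupp m hm
    have hD0 : D = 0 := by simpa using (hfD 0 hm).symm
    have hfs : f = Finsupp.single 0 (f 0) := by
      ext m
      by_cases h : m = 0
      · subst h; simp
      · rw [Finsupp.single_eq_of_ne h]
        by_contra hne
        exact h (hsupp m (Finsupp.mem_support_iff.2 hne))
    rw [filt_eq_bot H.wt_pos (by omega), Submodule.mem_bot, sub_eq_zero] at hx
    refine ⟨f 0, Finsupp.mem_support_iff.1 hm, ?_⟩
    rw [hfs, realize_single, Multiset.toList_zero, word_nil] at hx
    rwa [← hx]
  | succ n ih =>
    intro D f x hD hf hfD hx hxN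
    by_cases hDn : D.toNat ≤ n
    · exact ih D f x hDn hf hfD hx hxN
    obtain ⟨m, hm⟩ := Finsupp.support_nonempty_iff.2 hf
    have hm0 : m ≠ 0 := by
      rintro rfl
      have := hfD 0 hm
      simp at this
      omega
    obtain ⟨i, hi⟩ := Multiset.exists_mem_of_ne_zero hm0
    have hwi := H.wt_pos i
    refine ih (D - wt i) (formalDeriv π i f) ⁅c i, x⁆ (by omega) ?_ ?_ ?_ (N.lie_mem hxN)
    · intro h0
      have h1 := formalDeriv_apply (π := π) i f (m.erase i)
      rw [h0, Finsupp.zero_apply, Multiset.cons_erase hi, eq_comm,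
        ← Nat.cast_smul_eq_nsmul K, smul_eq_zero] at h1
      rcases h1 with h1 | h1
      · exact Nat.cast_ne_zero.2 (Nat.succ_ne_zero _) h1
      · exact Finsupp.mem_support_iff.1 hm ((map_eq_zero_iff π H.injective).1 h1)
    · intro m' hm'
      have h1 : f (i ::ₘ m') ≠ 0 := by
        intro h0
        rw [Finsupp.mem_support_iff, formalDeriv_apply, h0, map_zero, smul_zero] at hm'
        exact hm' rfl
      have h2 := hfD _ (Finsupp.mem_support_iff.2 h1)
      rw [Multiset.map_cons, Multiset.sum_cons] at h2
      omega
    · have h1 := H.c_mem i _ _ hx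
      have h2 := H.lie_c_realize i f hfD
      rw [lie_sub] at h1
      have h3 := Submodule.add_mem _ (filt_mono (D' := D - wt i - 1) (by omega) h1) h2
      convert h3 using 1
      abel

include H in
/-- Every nonzero Lie submodule of the module generated from `V` by words meets the image of `V`. -/
theorem exists_ne_zero [CharZero K] (N : LieSubmodule K L M) {x : M} (hx0 : x ≠ 0) (hxN : x ∈ N)
    {D : ℤ} (hx : x ∈ filt b j wt D) : ∃ v, v ≠ 0 ∧ j v ∈ N := by
  suffices h : ∀ (n : ℕ) (D : ℤ), D < n → x ∈ filt b j wt D → ∃ v, v ≠ 0 ∧ j v ∈ N from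
    h (D.toNat + 1) D (by omega) hx
  intro n
  induction n with
  | zero =>
    intro D hD hx
    rw [filt_eq_bot H.wt_pos (by simpa using hD)] at hx
    exact absurd ((Submodule.mem_bot K).1 hx) hx0
  | succ n ih =>
    intro D hD hx
    obtain ⟨f, hf, hxf⟩ := H.exists_realize hx
    by_cases hf0 : f = 0
    · subst hf0
      rw [map_zero, sub_zero] at hxf
      exact ih (D - 1) (by push_cast at hD; omega) hxf
    · exact H.exists_of_leading N D.toNat D f x le_rfl hf0 hf hxf hxN

end IsDetected

end LoweringWords

/-! ### The weight filtration of a module generated over the subalgebra -/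

namespace AffineAge

open LoweringWords

/-- The weight of a mode outside `sub d₁ d₂ d₃`. The offsets `-2, 3, -3, 0` are chosen so that all
brackets other than those of a lowering mode with its detecting mode are of strictly lower order,
see `bound_lowering_lowering` and `bound_dual`. -/
def weight (d₁ d₂ d₃ : ℤ) : AgeGen → ℤ → ℤ
  | .e, n => 4 * (d₁ - n) - 2
  | .h, n => -4 * n + 3
  | .p, n => 4 * (d₂ - n) - 3
  | .q, n => 4 * (d₃ - n)
  | .z, _ => 0

/-- The modes that annihilate the inducing module. -/
def Deep (d₁ d₂ d₃ l : ℤ) : AgeGen → ℤ → Prop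
  | .e, n => l - d₃ < n
  | .h, n => l - d₂ < n
  | .p, n => l < n
  | .q, n => l - d₁ < n
  | .z, n => l + d₂ - d₁ ≤ n

/-- `Bound d₁ d₂ d₃ l g n r` says that the mode `g_n` raises the weight by at most `r`: modes
outside the subalgebra raise it by their own weight, the modes annihilating the inducing module
lower it (those of `z` by any amount, since they are central and thus act as zero), and the
remaining ones preserve it. -/
def Bound (d₁ d₂ d₃ l : ℤ) : AgeGen → ℤ → ℤ → Prop
  | .e, n, r => (n < d₁ → 4 * (d₁ - n) - 2 ≤ r) ∧ (d₁ ≤ n ∧ n ≤ l - d₃ → 0 ≤ r) ∧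
      (l - d₃ < n → -4 * (n - l + d₃) ≤ r)
  | .h, n, r => (n < 0 → -4 * n + 3 ≤ r) ∧ (0 ≤ n ∧ n ≤ l - d₂ → 0 ≤ r) ∧
      (l - d₂ < n → -4 * (n - l + d₂) + 3 ≤ r)
  | .p, n, r => (n < d₂ → 4 * (d₂ - n) - 3 ≤ r) ∧ (d₂ ≤ n ∧ n ≤ l → 0 ≤ r) ∧
      (l < n → -4 * (n - l) - 3 ≤ r)
  | .q, n, r => (n < d₃ → 4 * (d₃ - n) ≤ r) ∧ (d₃ ≤ n ∧ n ≤ l - d₁ → 0 ≤ r) ∧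
      (l - d₁ < n → -4 * (n - l + d₁) + 2 ≤ r)
  | .z, n, r => n < l + d₂ - d₁ → 0 ≤ r

/-- The partner `g'` of `g` for which `[g', g]` is a nonzero multiple of `p`; the value at `z` is
not used. -/
def dual : AgeGen → AgeGen
  | .e => .q
  | .h => .p
  | .p => .h
  | .q => .e
  | .z => .z

variable {d₁ d₂ d₃ l : ℤ}

theorem weight_pos {g : AgeGen} {n : ℤ} (h : ¬SubMode d₁ d₂ d₃ g n) : 0 < weight d₁ d₂ d₃ g n := by
  cases g <;> simp_all [SubMode, weight] <;> omega

theorem deep_dual {g : AgeGen} {n : ℤ}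
    (h : ¬SubMode d₁ d₂ d₃ g n) : Deep d₁ d₂ d₃ l (dual g) (l - n) := by
  cases g <;> simp_all [SubMode, Deep, dual]
  omega

theorem bound_lowering {g : AgeGen} {n : ℤ} {r : ℤ} (h : ¬SubMode d₁ d₂ d₃ g n)
    (hr : Bound d₁ d₂ d₃ l g n r) : weight d₁ d₂ d₃ g n ≤ r := by
  cases g <;> simp_all [SubMode, weight, Bound]

theorem bound_shallow {g : AgeGen} {n : ℤ} {r : ℤ}
    (h : SubMode d₁ d₂ d₃ g n) (h' : ¬Deep d₁ d₂ d₃ l g n) (hr : Bound d₁ d₂ d₃ l g n r) :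
    0 ≤ r := by
  cases g <;> simp_all [SubMode, Deep, Bound]
  omega

theorem bound_lie (hd : d₂ ≤ d₁ + d₃) (hdl : d₁ + d₃ ≤ l + 1) (hl : d₂ < l) {a b : AgeGen}
    {m n r : ℤ} (ha : SubMode d₁ d₂ d₃ a m) (hb : ¬SubMode d₁ d₂ d₃ b n)
    (hc : lieCoef a b ≠ 0) (hr : Bound d₁ d₂ d₃ l a m r) :
    Bound d₁ d₂ d₃ l (lieGen a b) (m + n) (r + weight d₁ d₂ d₃ b n) := by
  cases a <;> cases b <;> simp only [lieCoef, ne_eq, not_true_eq_false] at hc <;>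
    simp only [SubMode, lieGen, weight, Bound, not_le] at ha hb hr ⊢ <;> omega

theorem bound_lie_h (hl : d₂ < l) {m n r : ℤ}
    (hb : ¬SubMode d₁ d₂ d₃ .h n) (hr : Bound d₁ d₂ d₃ l .h m r) (hmn : m + n = 0) :
    0 ≤ r + weight d₁ d₂ d₃ .h n := by
  simp only [SubMode, weight, Bound, not_le] at hb hr ⊢
  omega

theorem bound_dual_self (hdl : d₁ + d₃ ≤ l + 1) (hl : d₂ < l) {g : AgeGen} {n : ℤ}
    (h : ¬SubMode d₁ d₂ d₃ g n) :
    Bound d₁ d₂ d₃ l (dual g) (l - n) (-weight d₁ d₂ d₃ g n) := by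
  cases g <;> simp only [SubMode, weight, Bound, dual, not_le, not_true_eq_false] at h ⊢ <;> omega

theorem bound_dual (hd : d₂ ≤ d₁ + d₃) (hdl : d₁ + d₃ ≤ l + 1) (hl : d₂ < l) {g g' : AgeGen}
    {n n' : ℤ} (h : ¬SubMode d₁ d₂ d₃ g n) (h' : ¬SubMode d₁ d₂ d₃ g' n')
    (hc : lieCoef (dual g) g' ≠ 0) (hne : g = g' → n ≠ n') :
    Bound d₁ d₂ d₃ l (lieGen (dual g) g') (l - n + n')
      (weight d₁ d₂ d₃ g' n' - weight d₁ d₂ d₃ g n - 1) := by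
  cases g <;> cases g' <;> simp only [dual, lieCoef, ne_eq, not_true_eq_false] at hc <;>
    simp only [SubMode, lieGen, dual, weight, Bound, not_le, forall_const, reduceCtorEq,
      IsEmpty.forall_iff] at h h' hne ⊢ <;> omega

theorem bound_lowering_lowering (hd : d₂ ≤ d₁ + d₃)
    {g g' : AgeGen} {n n' : ℤ} (h : ¬SubMode d₁ d₂ d₃ g n) (h' : ¬SubMode d₁ d₂ d₃ g' n')
    (hc : lieCoef g g' ≠ 0) :
    Bound d₁ d₂ d₃ l (lieGen g g') (n + n')
      (weight d₁ d₂ d₃ g n + weight d₁ d₂ d₃ g' n' - 1) := by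
  cases g <;> cases g' <;> simp only [lieCoef, ne_eq, not_true_eq_false] at hc <;>
    simp only [SubMode, lieGen, weight, Bound, not_le] at h h' ⊢ <;> omega

theorem bound_p (hl : d₂ < l) {g : AgeGen} {n : ℤ}
    (h : ¬SubMode d₁ d₂ d₃ g n) (hc : lieCoef .p g ≠ 0) :
    Bound d₁ d₂ d₃ l (lieGen .p g) (l + n) (weight d₁ d₂ d₃ g n - 1) := by
  cases g <;> simp only [lieCoef, ne_eq, not_true_eq_false] at hc <;>
    simp only [SubMode, lieGen, weight, Bound, not_le] at h ⊢ <;> omega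

variable {M V : Type*} [AddCommGroup M] [Module ℂ M] [LieRingModule AffineAge M]
  [LieModule ℂ AffineAge M] [AddCommGroup V] [Module ℂ V] {j : V →ₗ[ℂ] M}

variable (d₁ d₂ d₃) in
/-- The names of the modes outside `sub d₁ d₂ d₃`. -/
abbrev Lowering : Type := {a : AgeGen × ℤ // ¬SubMode d₁ d₂ d₃ a.1 a.2}

/-- The mode with a given name. -/
def Lowering.toAge (a : Lowering d₁ d₂ d₃) : AffineAge := mode (Age.gen a.1.1) a.1.2

variable (l) in
/-- The mode detecting a given lowering mode, normalized so that their bracket is `p_l`. -/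
def Lowering.detector (a : Lowering d₁ d₂ d₃) : AffineAge :=
  lieCoef (dual a.1.1) a.1.1 • mode (Age.gen (dual a.1.1)) (l - a.1.2)

variable (d₁ d₂ d₃) in
/-- The weight filtration of `M`, whose zeroth step is the image of `j`. -/
abbrev wfilt (j : V →ₗ[ℂ] M) (D : ℤ) : Submodule ℂ M :=
  filt (Lowering.toAge (d₁ := d₁) (d₂ := d₂) (d₃ := d₃)) j
    (fun a => weight d₁ d₂ d₃ a.1.1 a.1.2) D

variable (d₁ d₂ d₃ l j) in
/-- The modes of the subalgebra and `k` preserve the image of `j`, and the deep modes annihilate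
it. -/
structure IsTruncated : Prop where
  preserves : ∀ g n, SubMode d₁ d₂ d₃ g n → ∀ v, ∃ v', ⁅mode (Age.gen g) n, j v⁆ = j v'
  preserves_k : ∀ v, ∃ v', ⁅k, j v⁆ = j v'
  deep : ∀ g n, Deep d₁ d₂ d₃ l g n → ∀ v, ⁅mode (Age.gen g) n, j v⁆ = 0

theorem IsTruncated.k_mem (T : IsTruncated d₁ d₂ d₃ l j) {D : ℤ} {x : M}
    (hx : x ∈ wfilt d₁ d₂ d₃ j D) : ⁅k, x⁆ ∈ wfilt d₁ d₂ d₃ j D := by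
  rw [← add_zero D]
  refine lie_mem_filt (fun w v => ?_) hx
  rw [add_zero]
  induction w with
  | nil =>
    obtain ⟨v', hv'⟩ := T.preserves_k v
    rw [word_nil, hv']
    exact word_mem_filt (l := []) le_rfl v'
  | cons a w ih =>
    rw [word_cons, leibniz_lie, k_lie, zero_lie, zero_add, List.map_cons, List.sum_cons, add_comm]
    exact lie_lowering_mem_filt a ih

/-- To bound a bracket of modes it suffices to bound the resulting mode and the central term. -/
theorem lie_lie_mem (T : IsTruncated d₁ d₂ d₃ l j) {a b : AgeGen} {m n D r : ℤ} {x : M}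
    (hx : x ∈ wfilt d₁ d₂ d₃ j D)
    (hmode : lieCoef a b ≠ 0 → ⁅mode (Age.gen (lieGen a b)) (m + n), x⁆ ∈
      wfilt d₁ d₂ d₃ j (D + r))
    (hk : a = .h → b = .h → m + n = 0 → 0 ≤ r) :
    ⁅⁅mode (Age.gen a) m, mode (Age.gen b) n⁆, x⁆ ∈ wfilt d₁ d₂ d₃ j (D + r) := by
  rw [lie_basis, add_lie, smul_lie, smul_lie]
  refine Submodule.add_mem _ ?_ ?_
  · by_cases hc : lieCoef a b = 0
    · rw [hc, zero_smul]; exact Submodule.zero_mem _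
    · exact Submodule.smul_mem _ _ (hmode hc)
  · by_cases hab : a = .h ∧ b = .h
    · by_cases hmn : m + n = 0
      · exact Submodule.smul_mem _ _
          (filt_mono (by have := hk hab.1 hab.2 hmn; omega) (T.k_mem hx))
      · rw [if_neg hmn, zero_smul]; exact Submodule.zero_mem _
    · rw [form_gen_of_ne hab, mul_zero, ite_self, zero_smul]; exact Submodule.zero_mem _

/-- The bounds recorded in `Bound` hold for the action on the weight filtration. A mode of the
subalgebra is moved through a word letter by letter. -/
theorem IsTruncated.mode_mem (T : IsTruncated d₁ d₂ d₃ l j) (hd : d₂ ≤ d₁ + d₃)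
    (hdl : d₁ + d₃ ≤ l + 1) (hl : d₂ < l) {g : AgeGen} {n r D : ℤ}
    (hr : Bound d₁ d₂ d₃ l g n r) {x : M} (hx : x ∈ wfilt d₁ d₂ d₃ j D) :
    ⁅mode (Age.gen g) n, x⁆ ∈ wfilt d₁ d₂ d₃ j (D + r) := by
  by_cases hg : SubMode d₁ d₂ d₃ g n
  swap
  · refine filt_mono ?_ (lie_lowering_mem_filt (⟨(g, n), hg⟩ : Lowering d₁ d₂ d₃) hx)
    have := bound_lowering hg hr
    simp only
    omega
  refine lie_mem_filt (fun w v => ?_) hx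
  clear hx
  induction w generalizing g n r with
  | nil =>
    rw [word_nil]
    by_cases hdeep : Deep d₁ d₂ d₃ l g n
    · rw [T.deep g n hdeep]; exact Submodule.zero_mem _
    · obtain ⟨v', hv'⟩ := T.preserves g n hg v
      rw [hv']
      exact word_mem_filt (l := []) (by simpa using bound_shallow hg hdeep hr) v'
  | cons a w ih =>
    have hw : word Lowering.toAge j w v ∈ wfilt d₁ d₂ d₃ j
        (w.map fun a => weight d₁ d₂ d₃ a.1.1 a.1.2).sum := word_mem_filt le_rfl v
    have ih' : ∀ {g n r}, Bound d₁ d₂ d₃ l g n r → ⁅mode (Age.gen g) n, word Lowering.toAge j w v⁆ ∈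
        wfilt d₁ d₂ d₃ j ((w.map fun a => weight d₁ d₂ d₃ a.1.1 a.1.2).sum + r) := by
      intro g n r hr
      by_cases hg : SubMode d₁ d₂ d₃ g n
      · exact ih hr hg
      · refine filt_mono ?_ (lie_lowering_mem_filt (⟨(g, n), hg⟩ : Lowering d₁ d₂ d₃) hw)
        have := bound_lowering hg hr
        simp only
        omega
    rw [word_cons, leibniz_lie, List.map_cons, List.sum_cons]
    have h1 := lie_lie_mem T (a := g) (b := a.1.1) (m := n) (n := a.1.2)
      (r := r + weight d₁ d₂ d₃ a.1.1 a.1.2) hw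
      (fun hc => ih' (bound_lie hd hdl hl hg a.2 hc hr)) fun h1 h2 h3 => by
        have ha := a.2
        rw [h2] at ha ⊢
        subst h1
        exact bound_lie_h hl ha hr h3
    have h2 := lie_lowering_mem_filt a (ih hr hg)
    have e : weight d₁ d₂ d₃ a.1.1 a.1.2 + (w.map fun a => weight d₁ d₂ d₃ a.1.1 a.1.2).sum + r =
      (w.map fun a => weight d₁ d₂ d₃ a.1.1 a.1.2).sum +
        (r + weight d₁ d₂ d₃ a.1.1 a.1.2) := by ring
    rw [e]
    refine Submodule.add_mem _ h1 ?_
    rwa [add_assoc] at h2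

/-- Relative to the weight filtration, the modes outside the subalgebra are detected by their
partners. -/
theorem IsTruncated.isDetected (T : IsTruncated d₁ d₂ d₃ l j) (hd : d₂ ≤ d₁ + d₃)
    (hdl : d₁ + d₃ ≤ l + 1) (hl : d₂ < l) {π : V →ₗ[ℂ] V} (hπ : Function.Injective π)
    (hp : ∀ v, ⁅mode (Age.gen .p) l, j v⁆ = j (π v)) :
    IsDetected (Lowering.toAge (d₁ := d₁) (d₂ := d₂) (d₃ := d₃)) (Lowering.detector l) j
      (fun a => weight d₁ d₂ d₃ a.1.1 a.1.2) (mode (Age.gen .p) l) π where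
  wt_pos a := weight_pos a.2
  lie_P := hp
  injective := hπ
  lie_c a v := by
    rw [Lowering.detector, smul_lie, T.deep _ _ (deep_dual a.2), smul_zero]
  c_mem a D x hx := by
    rw [Lowering.detector, smul_lie, sub_eq_add_neg]
    exact Submodule.smul_mem _ _ (T.mode_mem hd hdl hl (bound_dual_self hdl hl a.2) hx)
  lie_cb_self := by
    rintro ⟨⟨g, n⟩, h⟩
    simp only [Lowering.detector, Lowering.toAge, smul_lie, lie_basis, sub_add_cancel]
    rw [form_gen_of_ne (by cases g <;> simp [dual])]
    cases g with
    | z => exact absurd trivial h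
    | _ => simp [dual, lieCoef, lieGen]
  lie_cb := by
    rintro ⟨⟨g, n⟩, h⟩ ⟨⟨g', n'⟩, h'⟩ hne D x hx
    simp only [Lowering.detector, Lowering.toAge, smul_lie]
    refine Submodule.smul_mem _ _ ?_
    rw [add_sub_assoc, add_sub_assoc]
    refine lie_lie_mem T hx (fun hc => T.mode_mem hd hdl hl ?_ hx) fun h1 h2 h3 => ?_
    · refine bound_dual hd hdl hl h h' hc ?_
      rintro rfl rfl
      exact hne rfl
    · subst h2
      have hg : g = .p := by cases g <;> simp_all [dual]
      subst hg
      simp only [SubMode, weight, not_le] at h h' h3 ⊢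
      omega
  lie_bb := by
    rintro ⟨⟨g, n⟩, h⟩ ⟨⟨g', n'⟩, h'⟩ D x hx
    rw [add_assoc, add_sub_assoc]
    refine lie_lie_mem T hx (fun hc => T.mode_mem hd hdl hl
      (bound_lowering_lowering hd h h' hc) hx) fun _ _ _ => ?_
    have h1 := weight_pos h
    have h2 := weight_pos h'
    simp only at h1 h2 ⊢
    omega
  lie_Pb := by
    rintro ⟨⟨g, n⟩, h⟩ D x hx
    rw [add_sub_assoc]
    exact lie_lie_mem T hx (fun hc => T.mode_mem hd hdl hl (bound_p hl h hc) hx)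
      fun h1 => nomatch h1

/-- Every mode respects the filtration up to some shift. -/
theorem exists_bound (g : AgeGen) (n : ℤ) : ∃ r, Bound d₁ d₂ d₃ l g n r := by
  cases g
  · exact ⟨max (4 * (d₁ - n) - 2) (max 0 (-4 * (n - l + d₃))), by simp only [Bound]; omega⟩
  · exact ⟨max (-4 * n + 3) (max 0 (-4 * (n - l + d₂) + 3)), by simp only [Bound]; omega⟩
  · exact ⟨max (4 * (d₂ - n) - 3) (max 0 (-4 * (n - l) - 3)), by simp only [Bound]; omega⟩
  · exact ⟨max (4 * (d₃ - n)) (max 0 (-4 * (n - l + d₁) + 2)), by simp only [Bound]; omega⟩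
  · exact ⟨0, fun _ => le_rfl⟩

end AffineAge

/-! ### Restrictedness, exhaustion by the filtration, and irreducibility -/

namespace AffineAge

section Restricted

variable {M : Type*} [AddCommGroup M] [LieRingModule AffineAge M]

/-- Almost all positive basis modes annihilate `w`. -/
def IsRestrictedAt (w : M) : Prop :=
  ∃ N : ℤ, ∀ m : ℤ, N ≤ m → ∀ g, ⁅mode (Age.gen g) m, w⁆ = 0

theorem IsRestrictedAt.add {w w' : M} (h : IsRestrictedAt w) (h' : IsRestrictedAt w') :
    IsRestrictedAt (w + w') := by
  obtain ⟨N, hN⟩ := h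
  obtain ⟨N', hN'⟩ := h'
  exact ⟨max N N', fun m hm g => by
    rw [lie_add, hN m (le_of_max_le_left hm), hN' m (le_of_max_le_right hm), add_zero]⟩

variable [Module ℂ M] [LieModule ℂ AffineAge M]

theorem IsRestrictedAt.smul {w : M} (h : IsRestrictedAt w) (c : ℂ) : IsRestrictedAt (c • w) := by
  obtain ⟨N, hN⟩ := h
  exact ⟨N, fun m hm g => by rw [lie_smul, hN m hm, smul_zero]⟩

theorem IsRestrictedAt.lie {w : M} (h : IsRestrictedAt w) (x : AffineAge) :
    IsRestrictedAt ⁅x, w⁆ := by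
  obtain ⟨N, hN⟩ := h
  have hx : x ∈ modeSpan fun _ _ => True := by rw [modeSpan_true]; trivial
  induction hx using Submodule.span_induction with
  | mem x hx =>
    obtain ⟨b, n, -, rfl⟩ | rfl := hx
    · refine ⟨max N (max (N - n) (1 - n)), fun m hm g => ?_⟩
      rw [leibniz_lie, hN m (by omega), lie_zero, add_zero, lie_basis, if_neg (by omega), zero_smul,
        add_zero, smul_lie, hN (m + n) (by omega), smul_zero]
    · exact ⟨N, fun m hm g => by
        rw [leibniz_lie, lie_k, zero_lie, zero_add, hN m hm, lie_zero]⟩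
  | zero => exact ⟨N, fun m hm g => by rw [zero_lie, lie_zero]⟩
  | add x y _ _ h h' => rw [add_lie]; exact h.add h'
  | smul c x _ h => rw [smul_lie]; exact h.smul c

end Restricted

/-- Words exhaust the submodule generated by `j`: the union of the filtration is stable under the
whole affine ageing algebra. -/
theorem IsTruncated.exists_mem_wfilt_lie {d₁ d₂ d₃ l : ℤ} {M V : Type*} [AddCommGroup M]
    [Module ℂ M] [LieRingModule AffineAge M] [LieModule ℂ AffineAge M] [AddCommGroup V] [Module ℂ V]
    {j : V →ₗ[ℂ] M} (T : IsTruncated d₁ d₂ d₃ l j) (hd : d₂ ≤ d₁ + d₃)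
    (hdl : d₁ + d₃ ≤ l + 1) (hl : d₂ < l) (x : AffineAge) {w : M}
    (hw : ∃ D, w ∈ wfilt d₁ d₂ d₃ j D) : ∃ D, ⁅x, w⁆ ∈ wfilt d₁ d₂ d₃ j D := by
  obtain ⟨D, hD⟩ := hw
  have hx : x ∈ modeSpan fun _ _ => True := by rw [modeSpan_true]; trivial
  induction hx using Submodule.span_induction with
  | mem x hx =>
    obtain ⟨g, n, -, rfl⟩ | rfl := hx
    · obtain ⟨r, hr⟩ := exists_bound (d₁ := d₁) (d₂ := d₂) (d₃ := d₃) (l := l) g n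
      exact ⟨D + r, T.mode_mem hd hdl hl hr hD⟩
    · exact ⟨D, T.k_mem hD⟩
  | zero => exact ⟨D, by rw [zero_lie]; exact Submodule.zero_mem _⟩
  | add x y _ _ h h' =>
    obtain ⟨D₁, h₁⟩ := h
    obtain ⟨D₂, h₂⟩ := h'
    refine ⟨max D₁ D₂, ?_⟩
    rw [add_lie]
    exact Submodule.add_mem _ (LoweringWords.filt_mono (le_max_left _ _) h₁)
      (LoweringWords.filt_mono (le_max_right _ _) h₂)
  | smul c x _ h =>
    obtain ⟨D₁, h₁⟩ := h
    exact ⟨D₁, by rw [smul_lie]; exact Submodule.smul_mem _ _ h₁⟩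

end AffineAge

open AffineAge LieInduced

theorem theorem4p1 (d₁ d₂ d₃ : ℤ) (hd : d₂ ≤ d₁ + d₃)
    {V : Type*} [AddCommGroup V] [Module ℂ V]
    [LieRingModule (AffineAge.sub d₁ d₂ d₃ hd) V] [LieModule ℂ (AffineAge.sub d₁ d₂ d₃ hd) V]
    (hV : LieModule.IsIrreducible ℂ (AffineAge.sub d₁ d₂ d₃ hd) V)
    (l : ℤ) (hl : d₂ < l)
    (ha : (AffineAge.sub d₁ d₂ d₃ hd).ActsInjectively V (AffineAge.mode Age.p l))
    (hb : ∀ i : ℤ, 1 ≤ i →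
      (AffineAge.sub d₁ d₂ d₃ hd).Annihilates V (AffineAge.mode Age.p (l + i)) ∧
      (AffineAge.sub d₁ d₂ d₃ hd).Annihilates V (AffineAge.mode Age.z (l + d₂ - d₁ + i - 1)) ∧
      (AffineAge.sub d₁ d₂ d₃ hd).Annihilates V (AffineAge.mode Age.e (l - d₃ + i)) ∧
      (AffineAge.sub d₁ d₂ d₃ hd).Annihilates V (AffineAge.mode Age.q (l - d₁ + i)) ∧
      (AffineAge.sub d₁ d₂ d₃ hd).Annihilates V (AffineAge.mode Age.h (l - d₂ + i))) :
    LieModule.IsIrreducible ℂ AffineAge (LieInduced (AffineAge.sub d₁ d₂ d₃ hd) V) ∧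
      AffineAge.IsRestricted (LieInduced (AffineAge.sub d₁ d₂ d₃ hd) V) := by
  -- the membership of `e_{l-d₃+1}` in the subalgebra bounds `d₁ + d₃`
  have hdl : d₁ + d₃ ≤ l + 1 := by
    obtain ⟨hmem, -⟩ := (hb 1 le_rfl).2.2.1
    have h1 : d₁ ≤ l - d₃ + 1 := mode_mem_sub_iff.1 hmem
    omega
  have hact : ∀ (x : AffineAge) (hx : x ∈ sub d₁ d₂ d₃ hd) (v : V),
      ⁅x, incl (sub d₁ d₂ d₃ hd) V v⁆ =
        incl (sub d₁ d₂ d₃ hd) V ⁅(⟨x, hx⟩ : sub d₁ d₂ d₃ hd), v⁆ :=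
    fun x hx v => lie_incl _ V ⟨x, hx⟩ v
  have hann : ∀ x, (sub d₁ d₂ d₃ hd).Annihilates V x →
      ∀ v, ⁅x, incl (sub d₁ d₂ d₃ hd) V v⁆ = 0 := by
    rintro x ⟨hx, h⟩ v
    rw [hact x hx, h, map_zero]
  have T : IsTruncated d₁ d₂ d₃ l (incl (sub d₁ d₂ d₃ hd) V) :=
    { preserves := fun g n h v => ⟨_, hact _ (mode_mem_sub_iff.2 h) v⟩
      preserves_k := fun v => ⟨_, hact _ (k_mem_sub d₁ d₂ d₃ hd) v⟩
      deep := by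
        intro g n h
        apply hann
        cases g <;> simp only [Deep] at h
        · have h1 := (hb (n - (l - d₃)) (by omega)).2.2.1
          rwa [add_sub_cancel] at h1
        · have h1 := (hb (n - (l - d₂)) (by omega)).2.2.2.2
          rwa [add_sub_cancel] at h1
        · have h1 := (hb (n - l) (by omega)).1
          rwa [add_sub_cancel] at h1
        · have h1 := (hb (n - (l - d₁)) (by omega)).2.2.2.1
          rwa [add_sub_cancel] at h1
        · have h1 := (hb (n - (l + d₂ - d₁) + 1) (by omega)).2.1
          rwa [show l + d₂ - d₁ + (n - (l + d₂ - d₁) + 1) - 1 = n by ring] at h1 }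
  have hinj : Function.Injective (incl (sub d₁ d₂ d₃ hd) V) :=
    incl_injective _ (by rw [sub_toSubmodule]; exact extends_top hd) V
  obtain ⟨hpS, hpinj⟩ := ha
  have H := T.isDetected hd hdl hl (π := LieModule.toEnd ℂ (sub d₁ d₂ d₃ hd) V ⟨_, hpS⟩) hpinj
    fun v => hact _ hpS v
  constructor
  · have hVn : Nontrivial V := LieModule.nontrivial_of_isIrreducible ℂ (sub d₁ d₂ d₃ hd) V
    have hne : Nontrivial (LieInduced (sub d₁ d₂ d₃ hd) V) := hinj.nontrivial
    refine LieModule.IsIrreducible.mk fun N hN => ?_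
    obtain ⟨x, hxN, hx0⟩ := (Submodule.ne_bot_iff _).1 (mt (LieSubmodule.toSubmodule_eq_bot N).1 hN)
    obtain ⟨D, hD⟩ : ∃ D, x ∈ wfilt d₁ d₂ d₃ (incl (sub d₁ d₂ d₃ hd) V) D := by
      refine LieInduced.induction _ V
        (C := fun y => ∃ D, y ∈ wfilt d₁ d₂ d₃ (incl (sub d₁ d₂ d₃ hd) V) D)
        (fun v => ⟨0, ?_⟩) ?_ ?_
        (fun y w hw => T.exists_mem_wfilt_lie hd hdl hl y hw) x
      · exact LoweringWords.word_mem_filt (l := []) le_rfl v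
      · rintro y y' ⟨D, hD⟩ ⟨D', hD'⟩
        exact ⟨max D D', Submodule.add_mem _ (LoweringWords.filt_mono (le_max_left _ _) hD)
          (LoweringWords.filt_mono (le_max_right _ _) hD')⟩
      · rintro c y ⟨D, hD⟩
        exact ⟨D, Submodule.smul_mem _ c hD⟩
    obtain ⟨v, hv0, hvN⟩ := H.exists_ne_zero N hx0 hxN hD
    -- the elements of `V` lying in `N` form a nonzero submodule
    let N₀ : LieSubmodule ℂ (sub d₁ d₂ d₃ hd) V :=
      { (N : Submodule ℂ (LieInduced (sub d₁ d₂ d₃ hd) V)).comap (incl (sub d₁ d₂ d₃ hd) V) with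
        lie_mem := fun {s v} hv => by
          change incl (sub d₁ d₂ d₃ hd) V ⁅s, v⁆ ∈ N
          rw [← lie_incl]
          exact N.lie_mem hv }
    have hN₀ : N₀ = ⊤ := (eq_bot_or_eq_top N₀).resolve_left fun h => hv0 <| by
      have : v ∈ N₀ := hvN
      rwa [h, LieSubmodule.mem_bot] at this
    refine eq_top_iff.2 fun y _ => LieInduced.induction _ V (C := (· ∈ N)) (fun v => ?_)
      (fun _ _ => N.add_mem) (fun c _ => N.smul_mem c) (fun x m => N.lie_mem) y
    have : v ∈ N₀ := by rw [hN₀]; trivial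
    exact this
  · intro w
    obtain ⟨N, hN⟩ : IsRestrictedAt w := by
      refine LieInduced.induction _ V (fun v => ?_) (fun _ _ h h' => h.add h')
        (fun c _ h => h.smul c) (fun x _ h => h.lie x) w
      refine ⟨|l| + |d₁| + |d₂| + |d₃| + 1, fun m hm g => T.deep g m ?_ v⟩
      have h1 := le_abs_self l
      have h2 := le_abs_self d₂
      have h3 := neg_abs_le d₁
      have h4 := neg_abs_le d₂
      have h5 := neg_abs_le d₃
      have h6 := abs_nonneg d₁
      have h7 := abs_nonneg d₂
      have h8 := abs_nonneg d₃
      cases g <;> simp only [Deep] <;> omega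
    exact ⟨N, fun m hm => ⟨hN m hm .e, hN m hm .p, hN m hm .q, hN m hm .h, hN m hm .z⟩⟩

end
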